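/- Let $(M,g)$ be a smooth Riemannian manifold of dimension $m\ge 2$, let $P\in M$, and let $\xi=(\xi^1,\dots,\xi^m)$ be geodesic coordinates centered at $P$, i.e. a smooth chart sending $P$ to $0$ in which, near $0$, the curves $t\mapsto t\xi$ with $\|\xi\|=1$ are unit speed geodesics. Let $\Theta_P(\xi)=\|\xi\|^{m-1}\sqrt{\det(g_{ij}(\xi))}$ be the volume density in geodesic polar coordinates. Let $R(X,Y,Z,W)=g((\nabla_X\nabla_Y-\nabla_Y\nabla_X-\nabla_{[X,Y]})Z,W)$ be the curvature tensor, and for $k\ge 0$ let $\mathcal J_k(\xi)$ be the endomorphism of $T_PM$ defined by $$g(\mathcal J_k(\xi)\eta_1,\eta_2)=(\nabla^kR)(\eta_1,\xi,\xi,\eta_2;\xi,\dots,\xi),$$ so that $\mathcal J_0(\xi)$ is the Jacobi operator. Then: (1) There are functions $\mathcal H_k$ $(k\ge2)$ with $\mathcal H_k(c\xi)=c^k\mathcal H_k(\xi)$ for $c\in\mathbb R$ such that $\Theta_P(\xi)\sim\|\xi\|^{m-1}\bigl(1+\sum_{k\ge2}\mathcal H_k(\xi)\bigr)$ as $\xi\to0$,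 meaning that for every $N\ge0$ $$\Theta_P(\xi)-\|\xi\|^{m-1}\Bigl(1+\sum_{k=2}^{N}\mathcal H_k(\xi)\Bigr)=o\bigl(\|\xi\|^{m-1+N}\bigr).$$ (2) For every $n\ge2$, every such family $\mathcal H_k$ satisfies $$\mathcal H_n(\xi)=c_n\operatorname{Tr}\{\mathcal J_{n-2}(\xi)\}+\text{lower order terms},\qquad c_n=-\frac{n-1}{(n+1)!}.$$ Here "lower order terms" means a real linear combination of products of traces $\operatorname{Tr}\{\mathcal J_{k_1}(\xi)\cdots\mathcal J_{k_j}(\xi)\}$ with $j\ge1$ and all $k_i\le n-3$, in which every product of traces has total order $n$, where $\mathcal J_k$ is given the order $k+2$; its coefficients depend only on $n$ (not on $m$, $M$, $g$, $P$, the coordinates or $\xi$). (3) The number $c_n$ is the only one with this property: if, for some $n\ge2$ and some real number $c$, there is one expression of lower order terms as in (2) such that $\mathcal H_n(\xi)=c\operatorname{Tr}\{\mathcal J_{n-2}(\xi)\}+\text{lower order terms}$ for all Riemannian manifolds of all dimensions $m\ge2$, all $P$, all geodesic coordinates centered at $P$ and all $\xi$, then $c=-\frac{n-1}{(n+1)!}$.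 -/

import Mathlib

open scoped ContDiff Manifold Topology

universe u

noncomputable section

/-! ### Metrics in local coordinates -/

/-- The coordinate space `ℝ^m` with its Euclidean norm. -/
abbrev Coord (m : ℕ) : Type := EuclideanSpace ℝ (Fin m)

/-- The coordinate vector field `∂_i`. -/
def coordVec {m : ℕ} (i : Fin m) : Coord m := EuclideanSpace.single i 1

/-- The partial derivative `∂_i f` at `x`. -/
def partialDeriv {m : ℕ} (i : Fin m) (f : Coord m → ℝ) (x : Coord m) : ℝ :=
  fderiv ℝ f x (coordVec i)

/-- The Christoffel symbol `Γ_{ij}^k` at `x` of the metric with coefficient matrix `G`: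
`∇_{∂_i} ∂_j = ∑ k, Γ_{ij}^k ∂_k`. -/
def christoffel {m : ℕ} (G : Coord m → Matrix (Fin m) (Fin m) ℝ) (x : Coord m)
    (k i j : Fin m) : ℝ :=
  (1 / 2) * ∑ l, (G x)⁻¹ k l *
    (partialDeriv i (fun y => G y j l) x + partialDeriv j (fun y => G y i l) x
      - partialDeriv l (fun y => G y i j) x)

/-- The coefficient `R_{ijk}^l`, where `R(∂_i, ∂_j) ∂_k = ∑ l, R_{ijk}^l ∂_l` and
`R(X, Y) Z = ∇_X ∇_Y Z - ∇_Y ∇_X Z - ∇_{[X, Y]} Z`. -/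
def curvatureOp {m : ℕ} (G : Coord m → Matrix (Fin m) (Fin m) ℝ) (x : Coord m)
    (l i j k : Fin m) : ℝ :=
  partialDeriv i (fun y => christoffel G y l j k) x
    - partialDeriv j (fun y => christoffel G y l i k) x
    + ∑ s, (christoffel G x l i s * christoffel G x s j k
        - christoffel G x l j s * christoffel G x s i k)

/-- A field of covariant tensors of rank `q`, through its components. -/
abbrev CovTensor (m q : ℕ) : Type := Coord m → (Fin q → Fin m) → ℝ

/-- The curvature tensor `R(X, Y, Z, W) = g(R(X, Y) Z, W)`, as a covariant tensor of rank 4.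
With this sign, `R(X, Y, Y, X)` is positive on round spheres. -/
def curvatureTensor {m : ℕ} (G : Coord m → Matrix (Fin m) (Fin m) ℝ) : CovTensor m 4 :=
  fun x I => ∑ l, curvatureOp G x l (I 0) (I 1) (I 2) * G x l (I 3)

/-- The covariant derivative `∇T` of a covariant tensor field; the direction of differentiation
is the last index: `(∇T)(v_1, …, v_q; w) = (∇_w T)(v_1, …, v_q)`. -/
def covDeriv {m q : ℕ} (G : Coord m → Matrix (Fin m) (Fin m) ℝ) (T : CovTensor m q) :
    CovTensor m (q + 1) :=
  fun x I =>
    partialDeriv (I (Fin.last q)) (fun y => T y (Fin.init I)) x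
      - ∑ a : Fin q, ∑ s : Fin m,
          christoffel G x s (I (Fin.last q)) (Fin.init I a)
            * T x (Function.update (Fin.init I) a s)

/-- The `k`-th covariant derivative `∇^k R` of the curvature tensor. -/
def covDerivCurvature {m : ℕ} (G : Coord m → Matrix (Fin m) (Fin m) ℝ) :
    (k : ℕ) → CovTensor m (4 + k)
  | 0 => curvatureTensor G
  | k + 1 => covDeriv G (covDerivCurvature G k)

/-- The value `T(v_1, …, v_q)` at the point `x`. -/
def CovTensor.apply {m q : ℕ} (T : CovTensor m q) (x : Coord m) (v : Fin q → Coord m) : ℝ :=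
  ∑ I : Fin q → Fin m, T x I * ∏ a, v a (I a)

/-- `(∇^k R)(η₁, ξ, ξ, η₂; ξ, …, ξ)` at the point `x`. -/
def jacobiForm {m : ℕ} (G : Coord m → Matrix (Fin m) (Fin m) ℝ) (x : Coord m) (k : ℕ)
    (ξ η₁ η₂ : Coord m) : ℝ :=
  (covDerivCurvature G k).apply x
    (fun a => if (a : ℕ) = 0 then η₁ else if (a : ℕ) = 3 then η₂ else ξ)

/-- The endomorphism `J_k(ξ)` of the tangent space at `x`, as a matrix in the basis `∂_i`. It is
determined by `g(J_k(ξ) η₁, η₂) = (∇^k R)(η₁, ξ, ξ, η₂; ξ, …, ξ)`, which for the coefficient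
matrix `G` of `g` and the matrix `B` of the bilinear form on the right reads `Jᵀ G = B`. -/
def jacobiOp {m : ℕ} (G : Coord m → Matrix (Fin m) (Fin m) ℝ) (x : Coord m) (k : ℕ)
    (ξ : Coord m) : Matrix (Fin m) (Fin m) ℝ :=
  (G x)⁻¹ * (Matrix.of fun i j => jacobiForm G x k ξ (coordVec i) (coordVec j)).transpose

/-- `γ` is a unit speed geodesic on the (open) set `s` of parameters. -/
def IsUnitSpeedGeodesicOn {m : ℕ} (G : Coord m → Matrix (Fin m) (Fin m) ℝ) (γ : ℝ → Coord m)
    (s : Set ℝ) : Prop :=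
  ContDiffOn ℝ 2 γ s ∧ ∀ t ∈ s,
    (∀ k, deriv (deriv γ) t k
      + ∑ i, ∑ j, christoffel G (γ t) k i j * deriv γ t i * deriv γ t j = 0) ∧
    ∑ i, ∑ j, G (γ t) i j * deriv γ t i * deriv γ t j = 1

/-! ### Riemannian manifolds and geodesic coordinates -/

section Manifold

variable {m : ℕ} {M : Type*} [TopologicalSpace M] [ChartedSpace (Coord m) M]
  [IsManifold 𝓘(ℝ, Coord m) ∞ M]

/-- The coefficients `g_{ij} = g(∂_i, ∂_j)` of the metric `g` in the chart `φ`, as a function of the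
coordinates. -/
def metricCoeff
    (g : Bundle.ContMDiffRiemannianMetric 𝓘(ℝ, Coord m) ∞ (Coord m)
      (fun p : M => TangentSpace 𝓘(ℝ, Coord m) p))
    (φ : OpenPartialHomeomorph M (Coord m)) (x : Coord m) : Matrix (Fin m) (Fin m) ℝ :=
  Matrix.of fun i j =>
    g.inner (φ.symm x)
      (mfderiv 𝓘(ℝ, Coord m) 𝓘(ℝ, Coord m) φ.symm x (coordVec i))
      (mfderiv 𝓘(ℝ, Coord m) 𝓘(ℝ, Coord m) φ.symm x (coordVec j))

/-- The smooth chart `φ` is a system of geodesic coordinates centered at `P`: it sends `P` to the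
origin, and for `‖ξ‖ = 1` the curves `t ↦ t ξ` are unit speed geodesics (as long as `|t|` is small
enough, uniformly in `ξ`). -/
structure IsGeodesicCoordinates
    (g : Bundle.ContMDiffRiemannianMetric 𝓘(ℝ, Coord m) ∞ (Coord m)
      (fun p : M => TangentSpace 𝓘(ℝ, Coord m) p))
    (P : M) (φ : OpenPartialHomeomorph M (Coord m)) : Prop where
  mem_maximalAtlas : φ ∈ IsManifold.maximalAtlas 𝓘(ℝ, Coord m) ∞ M
  mem_source : P ∈ φ.source
  map_center : φ P = 0
  geodesic : ∃ ρ > 0, Metric.ball 0 ρ ⊆ φ.target ∧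
    ∀ ξ : Coord m, ‖ξ‖ = 1 →
      IsUnitSpeedGeodesicOn (metricCoeff g φ) (fun t => t • ξ) (Set.Ioo (-ρ) ρ)

/-- The volume density `Θ_P(ξ) = ‖ξ‖^(m-1) √(det g_{ij}(ξ))` in geodesic polar coordinates. -/
def volumeDensity
    (g : Bundle.ContMDiffRiemannianMetric 𝓘(ℝ, Coord m) ∞ (Coord m)
      (fun p : M => TangentSpace 𝓘(ℝ, Coord m) p))
    (φ : OpenPartialHomeomorph M (Coord m)) (ξ : Coord m) : ℝ :=
  ‖ξ‖ ^ (m - 1) * √((metricCoeff g φ ξ).det)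

/-- The functions `H_k`, `k ≥ 2`, are the homogeneous terms of the asymptotic expansion
`Θ_P(ξ) ∼ ‖ξ‖^(m-1) (1 + ∑_{k ≥ 2} H_k(ξ))` at the origin. (The values of `H 0` and `H 1` play
no role.) -/
def IsDensityExpansion
    (g : Bundle.ContMDiffRiemannianMetric 𝓘(ℝ, Coord m) ∞ (Coord m)
      (fun p : M => TangentSpace 𝓘(ℝ, Coord m) p))
    (φ : OpenPartialHomeomorph M (Coord m)) (H : ℕ → Coord m → ℝ) : Prop :=
  (∀ k, 2 ≤ k → ∀ (c : ℝ) (ξ : Coord m), H k (c • ξ) = c ^ k * H k ξ) ∧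
  ∀ N : ℕ, (fun ξ : Coord m =>
      volumeDensity g φ ξ - ‖ξ‖ ^ (m - 1) * (1 + ∑ k ∈ Finset.Icc 2 N, H k ξ))
    =o[𝓝 0] fun ξ => ‖ξ‖ ^ (m - 1 + N)

end Manifold

/-! ### Lower order terms -/

/-- Formal polynomials in the symbols `Tr{J_{k_1} ⋯ J_{k_j}}`; the symbol is encoded by the list
`[k_1, …, k_j]`. -/
abbrev TracePoly : Type := MvPolynomial (List ℕ) ℝ

/-- The value of a trace polynomial on a sequence of matrices. -/
def TracePoly.value {m : ℕ} (L : TracePoly) (J : ℕ → Matrix (Fin m) (Fin m) ℝ) : ℝ :=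
  MvPolynomial.eval (fun w : List ℕ => (w.map J).prod.trace) L

/-- The formal expression `L` is admissible as the lower order terms of `H_n`: it involves only the
traces of nonempty products of `J_0, …, J_{n-3}`, and every monomial has total order `n`, where
`J_k` has order `k + 2`. -/
def TracePoly.IsLowerOrder (L : TracePoly) (n : ℕ) : Prop :=
  (∀ w ∈ L.vars, w ≠ [] ∧ ∀ k ∈ w, k + 2 < n) ∧
  L.IsWeightedHomogeneous (fun w : List ℕ => (w.map (fun k => k + 2)).sum) n

/-- `H_n(ξ) = c Tr{J_{n-2}(ξ)} + lower order terms`, where the lower order terms are given by one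
universal expression, the same for all Riemannian manifolds of all dimensions `m ≥ 2`, all points
and all geodesic coordinates. -/
def IsLeadingCoeff (n : ℕ) (c : ℝ) : Prop :=
  ∃ L : TracePoly, L.IsLowerOrder n ∧
    ∀ (m : ℕ) (_ : 2 ≤ m) (M : Type u) [TopologicalSpace M] [ChartedSpace (Coord m) M]
      [IsManifold 𝓘(ℝ, Coord m) ∞ M]
      (g : Bundle.ContMDiffRiemannianMetric 𝓘(ℝ, Coord m) ∞ (Coord m)
        (fun p : M => TangentSpace 𝓘(ℝ, Coord m) p))
      (P : M) (φ : OpenPartialHomeomorph M (Coord m)) (_ : IsGeodesicCoordinates g P φ)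
      (H : ℕ → Coord m → ℝ) (_ : IsDensityExpansion g φ H) (ξ : Coord m),
      H n ξ = c * (jacobiOp (metricCoeff g φ) 0 (n - 2) ξ).trace
        + L.value (fun k => jacobiOp (metricCoeff g φ) 0 k ξ)

end

/-! Everything happens along a single ray `t ↦ t ξ`. Let `A(t)` be the matrix of `∇_ξ` in the
coordinate frame and `D = d/dt + [A, ·]` the induced covariant derivative on endomorphisms.
Differentiating the geodesic identity `Γ^l_{ab}(x) x^a x^b = 0` in a transverse direction and
inserting the result in the definition of curvature gives the Riccati equation `t A' + 2 A + t A² +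
t J_0 = 0` (`IsSmoothMetricOn.riccati`). Since the ray is a geodesic, `D J_k = J_{k+1}`
(`IsSmoothMetricOn.hasCovDerivAt_jacobiOp`), and metric compatibility gives `θ' = (Tr A) θ` for `θ =
√det g` (`hasDerivAt_sqrt_det`).

Let `A_k` be the value of `D^k A / k!` at `t = 0` and `θ_n` the Taylor coefficients of `θ`. As `D A
= A'` and the trace turns `D` into `d/dt`, the equations become the recurrences `(k+3) A_{k+1} = -(∑
A_i A_j + J_k / k!)` and `(n+1) θ_{n+1} = ∑ Tr(A_i) θ_j` (`radial_recurrences`). They are purely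
algebraic and the same for all metrics, so `θ_{n+2}` is a universal trace polynomial; `J_n` enters
it only through `Tr(A_{n+1}) / (n+2)`, with coefficient `-1 / ((n+2)(n+3) n!) = -(n+1) / (n+3)!`
(`RadialData.exists_tracePoly`). Taylor's formula shows that the `θ_k` form a density expansion, and
homogeneity makes such an expansion unique.

For the uniqueness of the constant, a plane metric is chosen for which `θ = 1 + t^n + t^{2n}` along
one axis and the connection matrix has only one nonzero entry there. The recurrences, read
backwards, force `J_k = 0` for `k < n - 2`, so every lower order expression vanishes and `1 = c Tr
J_{n-2}` determines `c`. The curvature of this metric never has to be computed. -/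

noncomputable section

/-! ### Universal solutions of the radial recurrences -/

/-- The Taylor coefficients, along a ray, of the Jacobi operators `J`, of the connection matrix `A`
and of the density `θ`, with the recurrences that relate them. -/
structure RadialData where
  m : ℕ
  J : ℕ → Matrix (Fin m) (Fin m) ℝ
  A : ℕ → Matrix (Fin m) (Fin m) ℝ
  θ : ℕ → ℝ
  A_zero : A 0 = 0
  A_succ : ∀ k : ℕ, ((k : ℝ) + 3) • A (k + 1) =
    -(∑ p ∈ Finset.HasAntidiagonal.antidiagonal k, A p.1 * A p.2 + ((k.factorial : ℝ)⁻¹) • J k)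
  θ_zero : θ 0 = 1
  θ_succ : ∀ n : ℕ, ((n : ℝ) + 1) * θ (n + 1) =
    ∑ p ∈ Finset.HasAntidiagonal.antidiagonal n, (A p.1).trace * θ p.2

namespace RadialData

/-- The linear combinations of the words `J_{k_1} ⋯ J_{k_j}`, `j ≥ 1`, of order `n` in the letters
`J_k` of order less than `b`. -/
def wordSpan (n b : ℕ) : Submodule ℝ ((d : RadialData) → Matrix (Fin d.m) (Fin d.m) ℝ) :=
  Submodule.span ℝ {F | ∃ w : List ℕ, w ≠ [] ∧ (∀ k ∈ w, k + 2 < b) ∧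
    (w.map (fun k => k + 2)).sum = n ∧ F = fun d => (w.map d.J).prod}

lemma wordSpan_mono {n b b' : ℕ} (h : b ≤ b') : wordSpan n b ≤ wordSpan n b' := by
  apply Submodule.span_mono
  rintro F ⟨w, h1, h2, h3, h4⟩
  exact ⟨w, h1, fun k hk => (h2 k hk).trans_le h, h3, h4⟩

lemma letter_mem_wordSpan (k : ℕ) : (fun d : RadialData => d.J k) ∈ wordSpan (k + 2) (k + 3) :=
  Submodule.subset_span ⟨[k], by simp, by simp, by simp, by simp⟩

/-- Concatenation of words adds their orders, and by bilinearity it suffices to check generators. -/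
lemma mul_mem_wordSpan {n n' b : ℕ} {F F' : (d : RadialData) → Matrix (Fin d.m) (Fin d.m) ℝ}
    (hF : F ∈ wordSpan n b) (hF' : F' ∈ wordSpan n' b) : F * F' ∈ wordSpan (n + n') b := by
  have h := Submodule.mul_mem_mul hF hF'
  rw [wordSpan, wordSpan, Submodule.span_mul_span] at h
  refine Submodule.span_mono ?_ h
  rintro _ ⟨_, ⟨w, h1, h2, h3, rfl⟩, _, ⟨w', h1', h2', h3', rfl⟩, rfl⟩
  refine ⟨w ++ w', by simp [h1], ?_, by simp [h3, h3'], ?_⟩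
  · intro k hk
    rcases List.mem_append.1 hk with hk | hk
    exacts [h2 k hk, h2' k hk]
  · ext1 d
    simp

/-- The scalar functions given by trace polynomials of order `n` in the `J_k` of order less
than `b`. -/
def traceSpan (n b : ℕ) : Submodule ℝ (RadialData → ℝ) where
  carrier := {f | ∃ L : TracePoly, (∀ w ∈ L.vars, w ≠ [] ∧ ∀ k ∈ w, k + 2 < b) ∧
    L.IsWeightedHomogeneous (fun w : List ℕ => (w.map (fun k => k + 2)).sum) n ∧
    ∀ d, f d = L.value d.J}
  zero_mem' := ⟨0, by simp, MvPolynomial.isWeightedHomogeneous_zero _ _ _,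
    fun d => by simp [TracePoly.value]⟩
  add_mem' := by
    rintro f f' ⟨L, h1, h2, h3⟩ ⟨L', h1', h2', h3'⟩
    refine ⟨L + L', fun w hw => ?_, h2.add h2', fun d => ?_⟩
    · rcases Finset.mem_union.1 (MvPolynomial.vars_add_subset L L' hw) with hw | hw
      exacts [h1 w hw, h1' w hw]
    · simp [TracePoly.value, h3, h3']
  smul_mem' := by
    rintro c f ⟨L, h1, h2, h3⟩
    refine ⟨MvPolynomial.C c * L, fun w hw => ?_, ?_, fun d => ?_⟩
    · rcases Finset.mem_union.1 (MvPolynomial.vars_mul _ _ hw) with hw | hw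
      · simp at hw
      · exact h1 w hw
    · simpa using (MvPolynomial.isWeightedHomogeneous_C _ c).mul h2
    · simp [TracePoly.value, h3]

lemma traceSpan_mono {n b b' : ℕ} (h : b ≤ b') : traceSpan n b ≤ traceSpan n b' := by
  rintro f ⟨L, h1, h2, h3⟩
  exact ⟨L, fun w hw => ⟨(h1 w hw).1, fun k hk => ((h1 w hw).2 k hk).trans_le h⟩, h2, h3⟩

lemma mul_mem_traceSpan {n n' b : ℕ} {f f' : RadialData → ℝ}
    (hf : f ∈ traceSpan n b) (hf' : f' ∈ traceSpan n' b) : f * f' ∈ traceSpan (n + n') b := by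
  obtain ⟨L, h1, h2, h3⟩ := hf
  obtain ⟨L', h1', h2', h3'⟩ := hf'
  refine ⟨L * L', fun w hw => ?_, h2.mul h2', fun d => ?_⟩
  · rcases Finset.mem_union.1 (MvPolynomial.vars_mul L L' hw) with hw | hw
    exacts [h1 w hw, h1' w hw]
  · simp [TracePoly.value, h3, h3']

lemma one_mem_traceSpan (b : ℕ) : (1 : RadialData → ℝ) ∈ traceSpan 0 b :=
  ⟨1, by simp, MvPolynomial.isWeightedHomogeneous_one _ _, fun d => by simp [TracePoly.value]⟩

lemma trace_mem_traceSpan {n b : ℕ} {F : (d : RadialData) → Matrix (Fin d.m) (Fin d.m) ℝ}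
    (hF : F ∈ wordSpan n b) : (fun d => (F d).trace) ∈ traceSpan n b := by
  induction hF using Submodule.span_induction with
  | mem F h =>
    obtain ⟨w, h1, h2, h3, rfl⟩ := h
    refine ⟨MvPolynomial.X w, fun w' hw => ?_, ?_, fun d => by simp [TracePoly.value]⟩
    · rw [MvPolynomial.vars_X, Finset.mem_singleton] at hw
      subst hw
      exact ⟨h1, h2⟩
    · have := MvPolynomial.isWeightedHomogeneous_X ℝ
        (fun w : List ℕ => (w.map (fun k => k + 2)).sum) w
      rwa [h3] at this
  | zero =>
    convert (traceSpan n b).zero_mem using 1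
    ext1 d
    simp
  | add F F' _ _ h h' =>
    convert (traceSpan n b).add_mem h h' using 1
    ext1 d
    simp [Matrix.trace_add]
  | smul c F _ h =>
    convert (traceSpan n b).smul_mem c h using 1
    ext1 d
    simp [Matrix.trace_smul]

lemma sum_mul_mem_wordSpan {k b : ℕ}
    (h : ∀ i ≤ k, (fun d : RadialData => d.A i) ∈ wordSpan (i + 1) b) :
    (fun d : RadialData => ∑ p ∈ Finset.HasAntidiagonal.antidiagonal k, d.A p.1 * d.A p.2) ∈
      wordSpan (k + 2) b := by
  have : (fun d : RadialData => ∑ p ∈ Finset.HasAntidiagonal.antidiagonal k, d.A p.1 * d.A p.2) =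
      ∑ p ∈ Finset.HasAntidiagonal.antidiagonal k,
        (fun d : RadialData => d.A p.1) * (fun d : RadialData => d.A p.2) := by
    ext1 d
    simp
  rw [this]
  refine Submodule.sum_mem _ fun p hp => ?_
  have hp' := Finset.HasAntidiagonal.mem_antidiagonal.1 hp
  have := mul_mem_wordSpan (h p.1 (by omega)) (h p.2 (by omega))
  rwa [show p.1 + 1 + (p.2 + 1) = k + 2 by omega] at this

lemma A_succ_eq (d : RadialData) (k : ℕ) : d.A (k + 1) =
    (-((k : ℝ) + 3)⁻¹) • ∑ p ∈ Finset.HasAntidiagonal.antidiagonal k, d.A p.1 * d.A p.2 +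
      (-(((k : ℝ) + 3)⁻¹ * (k.factorial : ℝ)⁻¹)) • d.J k := by
  have h3 : (k : ℝ) + 3 ≠ 0 := by positivity
  rw [← inv_smul_smul₀ h3 (d.A (k + 1)), d.A_succ]
  module

/-- Order bookkeeping in the Riccati recurrence: the products involve only earlier `A i`, and the
one new letter in `A (k + 1)` is `J k`, of order `k + 2`. The case `k = 0` needs `A 0 = 0`, since no
nonempty word has order 1. -/
lemma A_mem_wordSpan (k : ℕ) : (fun d : RadialData => d.A k) ∈ wordSpan (k + 1) (k + 2) := by
  induction k using Nat.strong_induction_on with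
  | _ k ih =>
    obtain _ | k := k
    · have : (fun d : RadialData => d.A 0) = 0 := by ext1 d; simp [d.A_zero]
      rw [this]
      exact Submodule.zero_mem _
    · have : (fun d : RadialData => d.A (k + 1)) =
          (-((k : ℝ) + 3)⁻¹) • (fun d : RadialData =>
            ∑ p ∈ Finset.HasAntidiagonal.antidiagonal k, d.A p.1 * d.A p.2) +
          (-(((k : ℝ) + 3)⁻¹ * (k.factorial : ℝ)⁻¹)) • (fun d : RadialData => d.J k) := by
        ext1 d
        exact d.A_succ_eq k
      rw [this]
      exact Submodule.add_mem _
        (Submodule.smul_mem _ _ (sum_mul_mem_wordSpan fun i hi =>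
          wordSpan_mono (by omega) (ih i (by omega))))
        (Submodule.smul_mem _ _ (letter_mem_wordSpan k))

lemma θ_succ_eq (d : RadialData) (n : ℕ) : d.θ (n + 1) =
    ((n : ℝ) + 1)⁻¹ * ∑ p ∈ Finset.HasAntidiagonal.antidiagonal n, (d.A p.1).trace * d.θ p.2 := by
  have h1 : (n : ℝ) + 1 ≠ 0 := by positivity
  rw [← d.θ_succ, inv_mul_cancel_left₀ h1]

lemma θ_mem_traceSpan (n : ℕ) : (fun d : RadialData => d.θ n) ∈ traceSpan n (n + 1) := by
  induction n using Nat.strong_induction_on with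
  | _ n ih =>
    obtain _ | n := n
    · have : (fun d : RadialData => d.θ 0) = 1 := by ext1 d; simp [d.θ_zero]
      rw [this]
      exact one_mem_traceSpan _
    · have : (fun d : RadialData => d.θ (n + 1)) = ((n : ℝ) + 1)⁻¹ •
          ∑ p ∈ Finset.HasAntidiagonal.antidiagonal n,
            (fun d : RadialData => (d.A p.1).trace) * (fun d : RadialData => d.θ p.2) := by
        ext1 d
        simp [θ_succ_eq]
      rw [this]
      refine Submodule.smul_mem _ _ (Submodule.sum_mem _ fun p hp => ?_)
      have hp' := Finset.HasAntidiagonal.mem_antidiagonal.1 hp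
      have := mul_mem_traceSpan (b := n + 1 + 1)
        (traceSpan_mono (by omega) (trace_mem_traceSpan (A_mem_wordSpan p.1)))
        (traceSpan_mono (by omega) (ih p.2 (by omega)))
      rwa [show p.1 + 1 + p.2 = n + 1 by omega] at this

/-- The shift `p.2 + 1` leaves out the term containing `θ 0`, which is the one that carries `A (n +
1)` and hence the top letter `J n`. What remains is of lower order. -/
lemma sum_antidiagonal_mem_traceSpan (n : ℕ) :
    (fun d : RadialData => ∑ p ∈ Finset.HasAntidiagonal.antidiagonal n,
      (d.A p.1).trace * d.θ (p.2 + 1)) ∈ traceSpan (n + 2) (n + 2) := by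
  have : (fun d : RadialData => ∑ p ∈ Finset.HasAntidiagonal.antidiagonal n,
      (d.A p.1).trace * d.θ (p.2 + 1)) = ∑ p ∈ Finset.HasAntidiagonal.antidiagonal n,
        (fun d : RadialData => (d.A p.1).trace) * (fun d : RadialData => d.θ (p.2 + 1)) := by
    ext1 d
    simp
  rw [this]
  refine Submodule.sum_mem _ fun p hp => ?_
  have hp' := Finset.HasAntidiagonal.mem_antidiagonal.1 hp
  have := mul_mem_traceSpan (b := n + 2)
    (traceSpan_mono (by omega) (trace_mem_traceSpan (A_mem_wordSpan p.1)))
    (traceSpan_mono (by omega) (θ_mem_traceSpan (p.2 + 1)))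
  rwa [show p.1 + 1 + (p.2 + 1) = n + 2 by omega] at this

/-- The Taylor coefficients of the density are universal trace polynomials in the Jacobi operators,
with an explicit leading coefficient. -/
theorem exists_tracePoly (n : ℕ) : ∃ L : TracePoly, L.IsLowerOrder (n + 2) ∧
    ∀ d : RadialData, d.θ (n + 2) =
      (-(((n + 2 : ℕ) : ℝ) - 1) / (Nat.factorial (n + 2 + 1) : ℝ)) * (d.J n).trace
        + L.value d.J := by
  have key : (fun d : RadialData => d.θ (n + 2) -
      (-(((n + 2 : ℕ) : ℝ) - 1) / (Nat.factorial (n + 2 + 1) : ℝ)) * (d.J n).trace) ∈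
      traceSpan (n + 2) (n + 2) := by
    have : (fun d : RadialData => d.θ (n + 2) -
        (-(((n + 2 : ℕ) : ℝ) - 1) / (Nat.factorial (n + 2 + 1) : ℝ)) * (d.J n).trace) =
        ((n : ℝ) + 2)⁻¹ • (fun d : RadialData => ∑ p ∈ Finset.HasAntidiagonal.antidiagonal n,
          (d.A p.1).trace * d.θ (p.2 + 1)) +
        (-(((n : ℝ) + 2)⁻¹ * ((n : ℝ) + 3)⁻¹)) • (fun d : RadialData =>
          (∑ p ∈ Finset.HasAntidiagonal.antidiagonal n, d.A p.1 * d.A p.2).trace) := by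
      ext1 d
      have h := d.θ_succ_eq (n + 1)
      -- Only the term `Tr(A (n + 1)) θ 0` contains `J n`. Its coefficient is `-1 / ((n+2)(n+3)
      -- n!)`, and multiplying numerator and denominator by `n + 1` gives the stated form.
      rw [Finset.Nat.sum_antidiagonal_succ', d.A_succ_eq, d.θ_zero] at h
      have hf : ((n + 2 + 1).factorial : ℝ) = ((n : ℝ) + 3) * (n + 2) * (n + 1) * n.factorial := by
        simp only [Nat.factorial_succ]
        push_cast
        ring
      have hn : (n.factorial : ℝ) ≠ 0 := by positivity
      have h1 : (n : ℝ) + 1 ≠ 0 := by positivity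
      have h2 : (n : ℝ) + 2 ≠ 0 := by positivity
      have h3 : (n : ℝ) + 3 ≠ 0 := by positivity
      rw [h, hf]
      simp only [Matrix.trace_add, Matrix.trace_smul, smul_eq_mul, Pi.add_apply, Pi.smul_apply]
      push_cast
      rw [show (n : ℝ) + 1 + 1 = n + 2 by ring]
      field_simp
      ring
    rw [this]
    exact Submodule.add_mem _ (Submodule.smul_mem _ _ (sum_antidiagonal_mem_traceSpan n))
      (Submodule.smul_mem _ _ (trace_mem_traceSpan (sum_mul_mem_wordSpan fun i hi =>
        wordSpan_mono (by omega) (A_mem_wordSpan i))))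
  obtain ⟨L, h1, h2, h3⟩ := key
  exact ⟨L, ⟨h1, h2⟩, fun d => by rw [← h3 d]; ring⟩

end RadialData

/-- Positive weighted degree excludes a constant monomial, so each monomial contains the trace of a
nonempty word, and the first letter of that word already vanishes. -/
lemma TracePoly.IsLowerOrder.value_eq_zero {L : TracePoly} {n m : ℕ} (h : L.IsLowerOrder n)
    (hn : n ≠ 0) {J : ℕ → Matrix (Fin m) (Fin m) ℝ} (hJ : ∀ k, k + 2 < n → J k = 0) :
    L.value J = 0 := by
  rw [TracePoly.value, MvPolynomial.eval_eq]
  refine Finset.sum_eq_zero fun s hs => ?_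
  have hs0 : s ≠ 0 := by
    rintro rfl
    have := h.2 (MvPolynomial.mem_support_iff.1 hs)
    simp at this
    exact hn this.symm
  obtain ⟨w, hw⟩ := Finsupp.support_nonempty_iff.2 hs0
  have hwv : w ∈ L.vars := (MvPolynomial.mem_vars_iff_mem_support w).2 ⟨s, hs, hw⟩
  obtain ⟨h1, h2⟩ := h.1 w hwv
  obtain ⟨k, w', rfl⟩ := List.exists_cons_of_ne_nil h1
  rw [Finset.prod_eq_zero hw, mul_zero]
  rw [List.map_cons, List.prod_cons, hJ k (h2 k (by simp)), zero_mul, Matrix.trace_zero,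
    zero_pow (Finsupp.mem_support_iff.1 hw)]

/-! ### Covariant differentiation of matrix functions along a ray -/

/-- The matrix function `X` has derivative `X'` at `t`, entry by entry. -/
def HasMatDerivAt {m : ℕ} (X : ℝ → Matrix (Fin m) (Fin m) ℝ) (X' : Matrix (Fin m) (Fin m) ℝ)
    (t : ℝ) : Prop :=
  ∀ i j, HasDerivAt (fun s => X s i j) (X' i j) t

/-- The entrywise derivative of a matrix function. -/
def derivMat {m : ℕ} (X : ℝ → Matrix (Fin m) (Fin m) ℝ) (t : ℝ) : Matrix (Fin m) (Fin m) ℝ :=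
  Matrix.of fun i j => deriv (fun s => X s i j) t

/-- The covariant derivative of the endomorphism field `X`, for the connection matrix `A`. -/
def covD {m : ℕ} (A X : ℝ → Matrix (Fin m) (Fin m) ℝ) (t : ℝ) : Matrix (Fin m) (Fin m) ℝ :=
  derivMat X t + A t * X t - X t * A t

/-- `Y` is the covariant derivative at `t` of the endomorphism field `X`. -/
def HasCovDerivAt {m : ℕ} (A X : ℝ → Matrix (Fin m) (Fin m) ℝ) (Y : Matrix (Fin m) (Fin m) ℝ)
    (t : ℝ) : Prop :=
  HasMatDerivAt X (Y - A t * X t + X t * A t) t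

section MatrixCalculus

variable {m : ℕ} {A X Y : ℝ → Matrix (Fin m) (Fin m) ℝ} {X' Y' : Matrix (Fin m) (Fin m) ℝ} {t : ℝ}

lemma HasMatDerivAt.add (hX : HasMatDerivAt X X' t) (hY : HasMatDerivAt Y Y' t) :
    HasMatDerivAt (fun s => X s + Y s) (X' + Y') t :=
  fun i j => (hX i j).add (hY i j)

lemma HasMatDerivAt.mul (hX : HasMatDerivAt X X' t) (hY : HasMatDerivAt Y Y' t) :
    HasMatDerivAt (fun s => X s * Y s) (X' * Y t + X t * Y') t := by
  intro i j
  simp only [Matrix.mul_apply, Matrix.add_apply, ← Finset.sum_add_distrib]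
  exact HasDerivAt.fun_sum fun k _ => (hX i k).mul (hY k j)

lemma HasMatDerivAt.smul {f : ℝ → ℝ} {f' : ℝ} (hf : HasDerivAt f f' t) (hX : HasMatDerivAt X X' t) :
    HasMatDerivAt (fun s => f s • X s) (f' • X t + f t • X') t :=
  fun i j => hf.mul (hX i j)

lemma HasMatDerivAt.transpose (hX : HasMatDerivAt X X' t) :
    HasMatDerivAt (fun s => (X s).transpose) X'.transpose t :=
  fun i j => hX j i

lemma HasMatDerivAt.unique (hX : HasMatDerivAt X X' t) (hX' : HasMatDerivAt X Y' t) : X' = Y' := by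
  ext i j
  exact (hX i j).unique (hX' i j)

lemma HasMatDerivAt.congr (hX : HasMatDerivAt X X' t) (h : Y =ᶠ[𝓝 t] X) : HasMatDerivAt Y X' t :=
  fun i j => (hX i j).congr_of_eventuallyEq (h.mono fun s hs => by simp only [hs])

lemma HasCovDerivAt.add (hX : HasCovDerivAt A X X' t) (hY : HasCovDerivAt A Y Y' t) :
    HasCovDerivAt A (fun s => X s + Y s) (X' + Y') t := by
  unfold HasCovDerivAt at *
  convert HasMatDerivAt.add hX hY using 1
  noncomm_ring

lemma HasCovDerivAt.mul (hX : HasCovDerivAt A X X' t) (hY : HasCovDerivAt A Y Y' t) :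
    HasCovDerivAt A (fun s => X s * Y s) (X' * Y t + X t * Y') t := by
  unfold HasCovDerivAt at *
  convert HasMatDerivAt.mul hX hY using 1
  noncomm_ring

lemma HasCovDerivAt.smul {f : ℝ → ℝ} {f' : ℝ} (hf : HasDerivAt f f' t) (hX : HasCovDerivAt A X X' t) :
    HasCovDerivAt A (fun s => f s • X s) (f' • X t + f t • X') t := by
  unfold HasCovDerivAt at *
  convert HasMatDerivAt.smul hf hX using 1
  simp only [smul_add, smul_sub, Matrix.mul_smul, Matrix.smul_mul]
  abel

lemma HasCovDerivAt.const_smul (c : ℝ) (hX : HasCovDerivAt A X X' t) :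
    HasCovDerivAt A (fun s => c • X s) (c • X') t := by
  simpa using HasCovDerivAt.smul (hasDerivAt_const t c) hX

lemma HasCovDerivAt.sum {ι : Type*} (S : Finset ι) {X : ι → ℝ → Matrix (Fin m) (Fin m) ℝ}
    {X' : ι → Matrix (Fin m) (Fin m) ℝ} (h : ∀ i ∈ S, HasCovDerivAt A (X i) (X' i) t) :
    HasCovDerivAt A (fun s => ∑ i ∈ S, X i s) (∑ i ∈ S, X' i) t := by
  unfold HasCovDerivAt at *
  intro i j
  have h' : HasDerivAt (fun s => ∑ k ∈ S, X k s i j)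
      (∑ k ∈ S, (X' k - A t * X k t + X k t * A t) i j) t :=
    HasDerivAt.fun_sum fun k hk => h k hk i j
  rw [← Matrix.sum_apply, Finset.sum_add_distrib, Finset.sum_sub_distrib, ← Finset.mul_sum,
    ← Finset.sum_mul] at h'
  simpa only [Matrix.sum_apply] using h'

/-- The commutator with the connection matrix has trace zero. This is how covariant Taylor
coefficients of `A` yield ordinary Taylor coefficients of `Tr A`. -/
lemma HasCovDerivAt.trace (hX : HasCovDerivAt A X X' t) :
    HasDerivAt (fun s => (X s).trace) X'.trace t := by
  have h : HasDerivAt (fun s => (X s).trace) (X' - A t * X t + X t * A t).trace t :=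
    HasDerivAt.fun_sum fun i _ => hX i i
  rwa [Matrix.trace_add, Matrix.trace_sub, Matrix.trace_mul_comm (A t), sub_add_cancel] at h

lemma HasCovDerivAt.eq_zero {I : Set ℝ} (hI : IsOpen I) (ht : t ∈ I) (h0 : ∀ s ∈ I, X s = 0)
    (hX : HasCovDerivAt A X X' t) : X' = 0 := by
  have h1 : HasMatDerivAt X 0 t := by
    have h2 : HasMatDerivAt (fun _ => (0 : Matrix (Fin m) (Fin m) ℝ)) 0 t :=
      fun i j => hasDerivAt_const t _
    exact h2.congr (Filter.mem_of_superset (hI.mem_nhds ht) h0)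
  have h3 := HasMatDerivAt.unique hX h1
  simpa [h0 t ht] using h3

end MatrixCalculus

/-! ### Towers of normalized iterated derivatives -/

/-- The Leibniz rule for derivatives divided by factorials: after reindexing, each term `F p`
receives the total weight `p.1 + p.2 = k + 1`. Terms lost in the shift have weight zero. -/
lemma sum_antidiagonal_succ_weighted {M : Type*} [AddCommGroup M] [Module ℝ M]
    (F : ℕ × ℕ → M) (k : ℕ) :
    ∑ p ∈ Finset.HasAntidiagonal.antidiagonal k,
      (((p.1 : ℝ) + 1) • F (p.1 + 1, p.2) + ((p.2 : ℝ) + 1) • F (p.1, p.2 + 1)) =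
    ((k : ℝ) + 1) • ∑ p ∈ Finset.HasAntidiagonal.antidiagonal (k + 1), F p := by
  have h : ((k : ℝ) + 1) • ∑ p ∈ Finset.HasAntidiagonal.antidiagonal (k + 1), F p =
      ∑ p ∈ Finset.HasAntidiagonal.antidiagonal (k + 1), (p.1 : ℝ) • F p +
      ∑ p ∈ Finset.HasAntidiagonal.antidiagonal (k + 1), (p.2 : ℝ) • F p := by
    rw [Finset.smul_sum, ← Finset.sum_add_distrib]
    refine Finset.sum_congr rfl fun p hp => ?_
    rw [← add_smul, ← Nat.cast_add, Finset.HasAntidiagonal.mem_antidiagonal.1 hp]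
    push_cast
    rfl
  rw [h, Finset.Nat.sum_antidiagonal_succ, Finset.Nat.sum_antidiagonal_succ',
    Finset.sum_add_distrib]
  simp

/-- `X k` is the `k`-th iterated covariant derivative of `X 0`, divided by `k!`. -/
def IsCovTower {m : ℕ} (A : ℝ → Matrix (Fin m) (Fin m) ℝ) (I : Set ℝ)
    (X : ℕ → ℝ → Matrix (Fin m) (Fin m) ℝ) : Prop :=
  ∀ k : ℕ, ∀ t ∈ I, HasCovDerivAt A (X k) (((k : ℝ) + 1) • X (k + 1) t) t

/-- `f k` is the `k`-th iterated derivative of `f 0`, divided by `k!`. -/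
def IsDerivTower (I : Set ℝ) (f : ℕ → ℝ → ℝ) : Prop :=
  ∀ k : ℕ, ∀ t ∈ I, HasDerivAt (f k) (((k : ℝ) + 1) * f (k + 1) t) t

section Towers

variable {m : ℕ} {A : ℝ → Matrix (Fin m) (Fin m) ℝ} {I : Set ℝ}
  {X Y : ℕ → ℝ → Matrix (Fin m) (Fin m) ℝ} {f g : ℕ → ℝ → ℝ}

lemma IsCovTower.add (hX : IsCovTower A I X) (hY : IsCovTower A I Y) :
    IsCovTower A I (fun k t => X k t + Y k t) := by
  intro k t ht
  rw [smul_add]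
  exact (hX k t ht).add (hY k t ht)

lemma IsCovTower.const_smul (c : ℝ) (hX : IsCovTower A I X) :
    IsCovTower A I (fun k t => c • X k t) := by
  intro k t ht
  rw [smul_comm]
  exact (hX k t ht).const_smul c

lemma IsCovTower.mul (hX : IsCovTower A I X) (hY : IsCovTower A I Y) :
    IsCovTower A I
      (fun k t => ∑ p ∈ Finset.HasAntidiagonal.antidiagonal k, X p.1 t * Y p.2 t) := by
  intro k t ht
  rw [← sum_antidiagonal_succ_weighted (fun p => X p.1 t * Y p.2 t)]
  refine HasCovDerivAt.sum _ fun p _ => ?_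
  convert (hX p.1 t ht).mul (hY p.2 t ht) using 1
  simp

lemma IsCovTower.shift (hX : IsCovTower A I X) :
    IsCovTower A I (fun k t => ((k : ℝ) + 1) • X (k + 1) t) := by
  intro k t ht
  convert (hX (k + 1) t ht).const_smul ((k : ℝ) + 1) using 1

/-- Since `t` has derivative 1, multiplication by `t` adds the preceding coefficient. At `t = 0`
only that one survives, so a factor `t` lowers the index by one. -/
lemma IsCovTower.id_smul (hX : IsCovTower A I X) :
    IsCovTower A I (fun k t => t • X k t + match k with | 0 => 0 | j + 1 => X j t) := by
  intro k t ht
  have h := HasCovDerivAt.smul (hasDerivAt_id' t) (hX k t ht)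
  obtain _ | k := k
  · convert h using 1
    · ext1 s
      simp
    · simp [add_comm]
  · convert h.add (hX k t ht) using 1
    push_cast
    module

lemma IsCovTower.eq_zero (hI : IsOpen I) (hX : IsCovTower A I X) (h0 : ∀ t ∈ I, X 0 t = 0)
    (k : ℕ) : ∀ t ∈ I, X k t = 0 := by
  induction k with
  | zero => exact h0
  | succ k ih =>
    intro t ht
    have h := (hX k t ht).eq_zero hI ht ih
    exact (smul_eq_zero.1 h).resolve_left (by positivity)

lemma IsCovTower.trace (hX : IsCovTower A I X) : IsDerivTower I (fun k t => (X k t).trace) := by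
  intro k t ht
  have := (hX k t ht).trace
  rwa [Matrix.trace_smul, smul_eq_mul] at this

lemma isCovTower_of_hasCovDerivAt
    (h : ∀ k : ℕ, ∀ t ∈ I, HasCovDerivAt A (X k) (X (k + 1) t) t) :
    IsCovTower A I (fun k t => (k.factorial : ℝ)⁻¹ • X k t) := by
  intro k t ht
  convert (h k t ht).const_smul (k.factorial : ℝ)⁻¹ using 1
  rw [smul_smul]
  congr 1
  have : (k.factorial : ℝ) ≠ 0 := by positivity
  have : (k : ℝ) + 1 ≠ 0 := by positivity
  rw [Nat.factorial_succ]
  push_cast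
  field_simp

lemma IsDerivTower.mul (hf : IsDerivTower I f) (hg : IsDerivTower I g) :
    IsDerivTower I
      (fun k t => ∑ p ∈ Finset.HasAntidiagonal.antidiagonal k, f p.1 t * g p.2 t) := by
  intro k t ht
  rw [← smul_eq_mul, ← sum_antidiagonal_succ_weighted (fun p => f p.1 t * g p.2 t)]
  refine HasDerivAt.fun_sum fun p _ => ?_
  refine ((hf p.1 t ht).mul (hg p.2 t ht)).congr_deriv ?_
  simp only [smul_eq_mul]
  ring

lemma IsDerivTower.shift (hf : IsDerivTower I f) :
    IsDerivTower I (fun k t => ((k : ℝ) + 1) * f (k + 1) t) := by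
  intro k t ht
  exact ((hf (k + 1) t ht).const_mul ((k : ℝ) + 1)).congr_deriv (by push_cast; ring)

lemma IsDerivTower.eq (hI : IsOpen I) (hf : IsDerivTower I f) (hg : IsDerivTower I g)
    (h0 : ∀ t ∈ I, f 0 t = g 0 t) (k : ℕ) : ∀ t ∈ I, f k t = g k t := by
  induction k with
  | zero => exact h0
  | succ k ih =>
    intro t ht
    have h := (hf k t ht).unique ((hg k t ht).congr_of_eventuallyEq
      (Filter.mem_of_superset (hI.mem_nhds ht) ih))
    exact mul_left_cancel₀ (by positivity) h

lemma contDiffOn_iteratedDeriv (hI : IsOpen I) {f : ℝ → ℝ} (hf : ContDiffOn ℝ ∞ f I) (k : ℕ) :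
    ContDiffOn ℝ ∞ (iteratedDeriv k f) I := by
  induction k with
  | zero => simpa using hf
  | succ k ih =>
    rw [iteratedDeriv_succ]
    exact ih.deriv_of_isOpen hI (by simp)

lemma isDerivTower_of_contDiffOn (hI : IsOpen I) {f : ℝ → ℝ} (hf : ContDiffOn ℝ ∞ f I) :
    IsDerivTower I (fun k t => (k.factorial : ℝ)⁻¹ * iteratedDeriv k f t) := by
  intro k t ht
  have h1 : HasDerivAt (iteratedDeriv k f) (iteratedDeriv (k + 1) f t) t := by
    rw [iteratedDeriv_succ]
    exact (((contDiffOn_iteratedDeriv hI hf k).contDiffAt (hI.mem_nhds ht)).differentiableAt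
      (by simp)).hasDerivAt
  refine (h1.const_mul (k.factorial : ℝ)⁻¹).congr_deriv ?_
  have : (k.factorial : ℝ) ≠ 0 := by positivity
  have : (k : ℝ) + 1 ≠ 0 := by positivity
  simp only [Nat.factorial_succ]
  push_cast
  field_simp

/-- Entrywise smoothness of a matrix function. -/
def IsSmoothMat (I : Set ℝ) (X : ℝ → Matrix (Fin m) (Fin m) ℝ) : Prop :=
  ∀ i j, ContDiffOn ℝ ∞ (fun t => X t i j) I

lemma IsSmoothMat.hasMatDerivAt (hI : IsOpen I) {X : ℝ → Matrix (Fin m) (Fin m) ℝ}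
    (hX : IsSmoothMat I X) {t : ℝ} (ht : t ∈ I) : HasMatDerivAt X (derivMat X t) t :=
  fun i j => (((hX i j).contDiffAt (hI.mem_nhds ht)).differentiableAt (by simp)).hasDerivAt

lemma IsSmoothMat.hasCovDerivAt (hI : IsOpen I) {X : ℝ → Matrix (Fin m) (Fin m) ℝ}
    (hX : IsSmoothMat I X) {t : ℝ} (ht : t ∈ I) : HasCovDerivAt A X (covD A X t) t := by
  have := hX.hasMatDerivAt hI ht
  unfold HasCovDerivAt covD
  convert this using 1
  abel

lemma IsSmoothMat.mul {X Y : ℝ → Matrix (Fin m) (Fin m) ℝ} (hX : IsSmoothMat I X)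
    (hY : IsSmoothMat I Y) : IsSmoothMat I (fun t => X t * Y t) := by
  intro i j
  simp only [Matrix.mul_apply]
  exact ContDiffOn.sum fun k _ => (hX i k).mul (hY k j)

lemma IsSmoothMat.derivMat (hI : IsOpen I) {X : ℝ → Matrix (Fin m) (Fin m) ℝ}
    (hX : IsSmoothMat I X) : IsSmoothMat I (derivMat X) :=
  fun i j => (hX i j).deriv_of_isOpen hI (by simp)

lemma IsSmoothMat.covD (hI : IsOpen I) (hA : IsSmoothMat I A) {X : ℝ → Matrix (Fin m) (Fin m) ℝ}
    (hX : IsSmoothMat I X) : IsSmoothMat I (covD A X) :=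
  fun i j => (((hX.derivMat hI) i j).add (hA.mul hX i j)).sub (hX.mul hA i j)

/-- The recurrences between the Taylor coefficients along a ray that follow from the Riccati
equation for the connection matrix and from `θ' = (Tr A) θ`. -/
theorem radial_recurrences (hI : IsOpen I) (h0 : (0 : ℝ) ∈ I) (hA : IsSmoothMat I A)
    {J : ℕ → ℝ → Matrix (Fin m) (Fin m) ℝ}
    (hJ : ∀ k : ℕ, ∀ t ∈ I, HasCovDerivAt A (J k) (J (k + 1) t) t)
    (hric : ∀ t ∈ I, t • derivMat A t + (2 : ℝ) • A t + t • (A t * A t) + t • J 0 t = 0)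
    {θ : ℝ → ℝ} (hθ : ContDiffOn ℝ ∞ θ I) (hθ0 : θ 0 = 1)
    (hθ' : ∀ t ∈ I, HasDerivAt θ ((A t).trace * θ t) t) :
    let B : ℕ → Matrix (Fin m) (Fin m) ℝ := fun k => (k.factorial : ℝ)⁻¹ • ((covD A)^[k] A) 0
    let Θ : ℕ → ℝ := fun n => (n.factorial : ℝ)⁻¹ * iteratedDeriv n θ 0
    B 0 = 0 ∧ (∀ k : ℕ, ((k : ℝ) + 3) • B (k + 1) =
      -(∑ p ∈ Finset.HasAntidiagonal.antidiagonal k, B p.1 * B p.2 +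
        ((k.factorial : ℝ)⁻¹) • J k 0)) ∧
    Θ 0 = 1 ∧ ∀ n : ℕ, ((n : ℝ) + 1) * Θ (n + 1) =
      ∑ p ∈ Finset.HasAntidiagonal.antidiagonal n, (B p.1).trace * Θ p.2 := by
  have hAk : ∀ k, IsSmoothMat I ((covD A)^[k] A) := by
    intro k
    induction k with
    | zero => exact hA
    | succ k ih =>
      rw [Function.iterate_succ_apply']
      exact hA.covD hI ih
  have tB : IsCovTower A I (fun k t => (k.factorial : ℝ)⁻¹ • ((covD A)^[k] A) t) := by
    refine isCovTower_of_hasCovDerivAt fun k t ht => ?_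
    rw [Function.iterate_succ_apply']
    exact (hAk k).hasCovDerivAt hI ht
  have tJ : IsCovTower A I (fun k t => (k.factorial : ℝ)⁻¹ • J k t) :=
    isCovTower_of_hasCovDerivAt hJ
  have tθ := isDerivTower_of_contDiffOn hI hθ
  -- The tower of the left side of the Riccati equation, written as `t (D A + A² + J_0) + 2 A`. Here
  -- `D A = A'` because `A` commutes with itself. The zeroth term vanishes on `I`, hence so do all
  -- the others.
  have tZ := (tB.shift.add ((tB.mul tB).add tJ)).id_smul.add (tB.const_smul 2)
  have hZ := tZ.eq_zero hI (fun t ht => by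
    have h := hric t ht
    have hcov : covD A A t = derivMat A t := by simp [covD]
    simp only [Nat.cast_zero, zero_add, one_smul, Finset.HasAntidiagonal.antidiagonal_zero,
      Finset.sum_singleton, Function.iterate_one, Function.iterate_zero, id_eq, Nat.factorial_one,
      Nat.factorial_zero, Nat.cast_one, inv_one, hcov, add_zero]
    rw [← h]
    simp only [smul_add]
    abel)
  have hθk := tθ.shift.eq hI (tB.trace.mul tθ) (fun t ht => by
    simp [(hθ' t ht).deriv])
  refine ⟨?_, fun k => ?_, by simp [hθ0], fun n => hθk n 0 h0⟩
  · have := hZ 0 0 h0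
    simpa using this
  -- At index `k + 1` and `t = 0` the factor `t` leaves the coefficient of index `k` of `D A + A² +
  -- J_0`. Its term `(k + 1) B (k + 1)` and the `2 B (k + 1)` from `2 A` add up to the factor `k +
  -- 3`.
  · have h := hZ (k + 1) 0 h0
    simp only [zero_smul, zero_add] at h
    rw [eq_neg_iff_add_eq_zero, ← h]
    module

end Towers

/-! ### Smooth metrics in coordinates -/

/-- The coefficient matrix `G` is symmetric everywhere, and on the set `U` it is smooth with
positive determinant. -/
structure IsSmoothMetricOn {m : ℕ} (G : Coord m → Matrix (Fin m) (Fin m) ℝ) (U : Set (Coord m)) :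
    Prop where
  smooth : ∀ i j, ContDiffOn ℝ ∞ (fun x => G x i j) U
  symm : ∀ x i j, G x i j = G x j i
  det_pos : ∀ x ∈ U, 0 < (G x).det

section Smoothness

variable {m : ℕ} {U : Set (Coord m)}

lemma contDiffOn_partialDeriv (hU : IsOpen U) {f : Coord m → ℝ} (hf : ContDiffOn ℝ ∞ f U)
    (i : Fin m) : ContDiffOn ℝ ∞ (partialDeriv i f) U :=
  (hf.fderiv_of_isOpen hU (by simp)).clm_apply contDiffOn_const

lemma contDiffOn_det {E : Type*} [NormedAddCommGroup E] [NormedSpace ℝ E] {U : Set E}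
    {X : E → Matrix (Fin m) (Fin m) ℝ}
    (hX : ∀ i j, ContDiffOn ℝ ∞ (fun x => X x i j) U) : ContDiffOn ℝ ∞ (fun x => (X x).det) U := by
  simp only [Matrix.det_apply']
  exact ContDiffOn.sum fun σ _ => contDiffOn_const.mul (contDiffOn_prod fun i _ => hX (σ i) i)

variable {G : Coord m → Matrix (Fin m) (Fin m) ℝ}

lemma IsSmoothMetricOn.contDiffOn_inv (h : IsSmoothMetricOn G U) (i j : Fin m) :
    ContDiffOn ℝ ∞ (fun x => (G x)⁻¹ i j) U := by
  simp only [Matrix.inv_def, Matrix.smul_apply, Ring.inverse_eq_inv', smul_eq_mul,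
    Matrix.adjugate_apply]
  refine ((contDiffOn_det h.smooth).inv fun x hx => (h.det_pos x hx).ne').mul
    (contDiffOn_det fun k l => ?_)
  by_cases hk : k = j
  · subst hk
    simp only [Matrix.updateRow_self]
    exact contDiffOn_const
  · simp only [Matrix.updateRow_ne hk]
    exact h.smooth k l

lemma IsSmoothMetricOn.contDiffOn_christoffel (h : IsSmoothMetricOn G U) (hU : IsOpen U)
    (k i j : Fin m) : ContDiffOn ℝ ∞ (fun x => christoffel G x k i j) U := by
  unfold christoffel
  exact contDiffOn_const.mul (ContDiffOn.sum fun l _ => (h.contDiffOn_inv k l).mul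
    (((contDiffOn_partialDeriv hU (h.smooth j l) i).add
      (contDiffOn_partialDeriv hU (h.smooth i l) j)).sub
      (contDiffOn_partialDeriv hU (h.smooth i j) l)))

lemma IsSmoothMetricOn.contDiffOn_curvatureOp (h : IsSmoothMetricOn G U) (hU : IsOpen U)
    (l i j k : Fin m) : ContDiffOn ℝ ∞ (fun x => curvatureOp G x l i j k) U := by
  unfold curvatureOp
  exact ((contDiffOn_partialDeriv hU (h.contDiffOn_christoffel hU l j k) i).sub
    (contDiffOn_partialDeriv hU (h.contDiffOn_christoffel hU l i k) j)).add
    (ContDiffOn.sum fun s _ =>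
      ((h.contDiffOn_christoffel hU l i s).mul (h.contDiffOn_christoffel hU s j k)).sub
      ((h.contDiffOn_christoffel hU l j s).mul (h.contDiffOn_christoffel hU s i k)))

lemma IsSmoothMetricOn.contDiffOn_covDerivCurvature (h : IsSmoothMetricOn G U) (hU : IsOpen U)
    (k : ℕ) (I : Fin (4 + k) → Fin m) :
    ContDiffOn ℝ ∞ (fun x => covDerivCurvature G k x I) U := by
  induction k with
  | zero =>
    change ContDiffOn ℝ ∞
      (fun x => ∑ l, curvatureOp G x l (I 0) (I 1) (I 2) * G x l (I 3)) U
    exact ContDiffOn.sum fun l _ => (h.contDiffOn_curvatureOp hU l _ _ _).mul (h.smooth l _)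
  | succ k ih =>
    exact (contDiffOn_partialDeriv hU (ih _) _).sub (ContDiffOn.sum fun a _ =>
      ContDiffOn.sum fun s _ => (h.contDiffOn_christoffel hU s _ _).mul (ih _))

lemma IsSmoothMetricOn.contDiffOn_jacobiForm (h : IsSmoothMetricOn G U) (hU : IsOpen U)
    (k : ℕ) (ξ η₁ η₂ : Coord m) :
    ContDiffOn ℝ ∞ (fun x => jacobiForm G x k ξ η₁ η₂) U :=
  ContDiffOn.sum fun I _ => (h.contDiffOn_covDerivCurvature hU k I).mul contDiffOn_const

end Smoothness

/-! ### Christoffel symbols, metric compatibility and polarization. -/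

section Christoffel

variable {m : ℕ} {U : Set (Coord m)} {G : Coord m → Matrix (Fin m) (Fin m) ℝ}

lemma IsSmoothMetricOn.christoffel_symm (h : IsSmoothMetricOn G U) (x : Coord m) (k i j : Fin m) :
    christoffel G x k i j = christoffel G x k j i := by
  unfold christoffel
  simp only [fun y => h.symm y i j]
  congr 1
  refine Finset.sum_congr rfl fun l _ => ?_
  ring

lemma IsSmoothMetricOn.sum_mul_christoffel (h : IsSmoothMetricOn G U) {x : Coord m} (hx : x ∈ U)
    (l i j : Fin m) : ∑ s, G x l s * christoffel G x s i j =
      (1 / 2) * (partialDeriv i (fun y => G y j l) x + partialDeriv j (fun y => G y i l) x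
        - partialDeriv l (fun y => G y i j) x) := by
  set c : Fin m → ℝ := fun l => partialDeriv i (fun y => G y j l) x +
    partialDeriv j (fun y => G y i l) x - partialDeriv l (fun y => G y i j) x with hc
  have h1 : (fun s => christoffel G x s i j) = (1 / 2 : ℝ) • ((G x)⁻¹.mulVec c) := by
    ext s
    rfl
  have h2 : (G x).mulVec (fun s => christoffel G x s i j) = (1 / 2 : ℝ) • c := by
    rw [h1, Matrix.mulVec_smul, Matrix.mulVec_mulVec, Matrix.mul_nonsing_inv _
      (isUnit_iff_ne_zero.2 (h.det_pos x hx).ne'), Matrix.one_mulVec]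
  exact congrFun h2 l

/-- Metric compatibility `∇g = 0`: in the sum of the two lowered Christoffel symbols all derivatives
cancel except `∂_i g_{jk}`, which occurs twice with factor one half. -/
lemma IsSmoothMetricOn.partialDeriv_eq (h : IsSmoothMetricOn G U) {x : Coord m} (hx : x ∈ U)
    (i j k : Fin m) : partialDeriv i (fun y => G y j k) x =
      ∑ s, (christoffel G x s i j * G x s k + G x j s * christoffel G x s i k) := by
  have h1 := h.sum_mul_christoffel hx k i j
  have h2 := h.sum_mul_christoffel hx j i k
  rw [show (fun y => G y k j) = fun y => G y j k from funext fun y => h.symm y k j] at h2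
  have h3 : ∀ s, christoffel G x s i j * G x s k = G x k s * christoffel G x s i j := fun s => by
    rw [h.symm x s k, mul_comm]
  rw [Finset.sum_add_distrib, h2]
  simp only [h3]
  rw [h1]
  ring

lemma eq_zero_of_quadratic_eq_zero {c : Fin m → Fin m → ℝ} (hc : ∀ i j, c i j = c j i)
    (h : ∀ ξ : Coord m, ∑ i, ∑ j, c i j * ξ i * ξ j = 0) (i j : Fin m) : c i j = 0 := by
  have e : ∀ i j, ∑ a, ∑ b, c a b * (coordVec i : Coord m) a * (coordVec j : Coord m) b = c i j := by
    intro i j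
    rw [Finset.sum_eq_single i, Finset.sum_eq_single j]
    · simp [coordVec]
    · intro b _ hb; simp [coordVec, hb]
    · simp
    · intro b _ hb; simp [coordVec, hb]
    · simp
  have h1 := h (coordVec i + coordVec j)
  simp only [PiLp.add_apply, mul_add, add_mul, Finset.sum_add_distrib, e] at h1
  have h2 := h (coordVec i)
  have h3 := h (coordVec j)
  rw [e] at h2 h3
  rw [h2, h3, hc j i] at h1
  linarith

end Christoffel

/-! ### The determinant along a curve -/

/-- Jacobi's formula. The product rule in the Leibniz expansion differentiates one column at a time,
and Cramer's rule identifies each resulting determinant with a diagonal entry of `adj(X) X'`. -/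
lemma HasMatDerivAt.det {m : ℕ} {X : ℝ → Matrix (Fin m) (Fin m) ℝ} {X' : Matrix (Fin m) (Fin m) ℝ}
    {t : ℝ} (hX : HasMatDerivAt X X' t) :
    HasDerivAt (fun s => (X s).det) ((X t).adjugate * X').trace t := by
  simp only [Matrix.det_apply']
  have h : HasDerivAt (fun s => ∑ σ : Equiv.Perm (Fin m), ((Equiv.Perm.sign σ : ℤ) : ℝ) *
      ∏ i, X s (σ i) i) (∑ σ : Equiv.Perm (Fin m), ((Equiv.Perm.sign σ : ℤ) : ℝ) *
      ∑ i, (∏ j ∈ Finset.univ.erase i, X t (σ j) j) • X' (σ i) i) t :=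
    HasDerivAt.fun_sum fun σ _ => (HasDerivAt.fun_finsetProd fun i _ => hX (σ i) i).const_mul _
  refine h.congr_deriv ?_
  simp only [Finset.mul_sum]
  rw [Finset.sum_comm]
  refine Finset.sum_congr rfl fun i _ => ?_
  have h1 : ((X t).adjugate * X') i i = ((X t).updateCol i (fun k => X' k i)).det := by
    rw [← Matrix.cramer_apply, Matrix.cramer_eq_adjugate_mulVec]
    rfl
  rw [Matrix.diag_apply, h1, Matrix.det_apply']
  refine Finset.sum_congr rfl fun σ _ => ?_
  rw [← Finset.mul_prod_erase _ _ (Finset.mem_univ i), Matrix.updateCol_self, smul_eq_mul,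
    mul_comm (X' (σ i) i)]
  congr 2
  refine Finset.prod_congr rfl fun j hj => ?_
  rw [Matrix.updateCol_ne (Finset.ne_of_mem_erase hj)]

/-- Both summands of `Aᵀ X + X A` contribute `det X · Tr A` to Jacobi's formula, and the square root
halves the total. -/
lemma hasDerivAt_sqrt_det {m : ℕ} {X A : ℝ → Matrix (Fin m) (Fin m) ℝ} {t : ℝ}
    (hX : HasMatDerivAt X ((A t).transpose * X t + X t * A t) t) (h0 : 0 < (X t).det) :
    HasDerivAt (fun s => √((X s).det)) ((A t).trace * √((X t).det)) t := by
  refine (hX.det.sqrt h0.ne').congr_deriv ?_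
  have h1 : ((X t).adjugate * ((A t).transpose * X t + X t * A t)).trace =
      2 * ((X t).det * (A t).trace) := by
    rw [mul_add, Matrix.trace_add, Matrix.trace_mul_comm, mul_assoc, Matrix.mul_adjugate,
      ← mul_assoc, Matrix.adjugate_mul]
    simp only [Matrix.mul_smul, Matrix.smul_mul, mul_one, one_mul, Matrix.trace_smul,
      Matrix.trace_transpose, smul_eq_mul]
    ring
  have h2 := Real.mul_self_sqrt h0.le
  have h3 : √((X t).det) ≠ 0 := (Real.sqrt_pos.2 h0).ne'
  rw [h1]
  nth_rewrite 1 [← h2]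
  field_simp

/-! ### Covariant tensors evaluated on vectors -/

lemma sum_fin_succ_pi {q : ℕ} {α M : Type*} [Fintype α] [AddCommMonoid M]
    (F : (Fin (q + 1) → α) → M) : ∑ I, F I = ∑ i, ∑ I : Fin q → α, F (Fin.cons i I) := by
  rw [← Fintype.sum_prod_type']
  exact (Fintype.sum_equiv (Fin.consEquiv fun _ => α) _ _ fun _ => rfl).symm

lemma sum_fin_succ_pi' {q : ℕ} {α M : Type*} [Fintype α] [AddCommMonoid M]
    (F : (Fin (q + 1) → α) → M) : ∑ I, F I = ∑ i, ∑ I : Fin q → α, F (Fin.snoc I i) := by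
  rw [← Fintype.sum_prod_type']
  exact (Fintype.sum_equiv (Fin.snocEquiv fun _ => α) _ _ fun _ => rfl).symm

/-- The coefficient vector of `∇_w v` at `x`, for constant `v`. -/
def christoffelVec {m : ℕ} (G : Coord m → Matrix (Fin m) (Fin m) ℝ) (x w v : Coord m) : Coord m :=
  WithLp.toLp 2 fun s => ∑ i, ∑ j, christoffel G x s i j * w i * v j

section Apply

variable {m q : ℕ} (T : CovTensor m q) (x : Coord m)

lemma prod_update_apply (v : Fin q → Coord m) (a : Fin q) (w : Coord m) (I : Fin q → Fin m) :
    ∏ b, (Function.update v a w) b (I b) = w (I a) * ∏ b ∈ Finset.univ.erase a, v b (I b) := by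
  rw [← Finset.mul_prod_erase _ _ (Finset.mem_univ a), Function.update_self]
  congr 1
  refine Finset.prod_congr rfl fun b hb => ?_
  rw [Function.update_of_ne (Finset.ne_of_mem_erase hb)]

lemma CovTensor.apply_update (v : Fin q → Coord m) (a : Fin q) (w : Coord m) :
    T.apply x (Function.update v a w) =
      ∑ s, w s * T.apply x (Function.update v a (coordVec s)) := by
  simp only [CovTensor.apply, prod_update_apply, Finset.mul_sum]
  rw [Finset.sum_comm]
  refine Finset.sum_congr rfl fun I _ => ?_
  rw [Finset.sum_eq_single (I a)]
  · simp [coordVec]; ring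
  · intro s _ hs; simp [coordVec, hs.symm]
  · simp

lemma CovTensor.apply_update_zero (v : Fin q → Coord m) (a : Fin q) :
    T.apply x (Function.update v a 0) = 0 := by
  rw [CovTensor.apply_update]
  simp

/-- The map exchanging `s` with the `a`-th entry of `I` is an involution. It moves a Christoffel
contraction from a slot of the tensor to the vector inserted there. -/
lemma sum_update_swap (a : Fin q) (F : (Fin q → Fin m) → Fin m → ℝ) :
    ∑ I : Fin q → Fin m, ∑ s, F (Function.update I a s) (I a) =
      ∑ I : Fin q → Fin m, ∑ s, F I s := by
  rw [← Fintype.sum_prod_type', ← Fintype.sum_prod_type']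
  have hinv : Function.Involutive
      (fun p : (Fin q → Fin m) × Fin m => (Function.update p.1 a p.2, p.1 a)) := by
    rintro ⟨I, s⟩
    simp
  exact Fintype.sum_equiv hinv.toPerm _ _ fun _ => rfl

lemma sum_christoffel_mul (G : Coord m → Matrix (Fin m) (Fin m) ℝ) (v : Fin q → Coord m)
    (w : Coord m) (a : Fin q) :
    ∑ i, ∑ I : Fin q → Fin m, (∑ s, christoffel G x s i (I a) * T x (Function.update I a s)) *
      ((∏ b, v b (I b)) * w i) =
      T.apply x (Function.update v a (christoffelVec G x w (v a))) := by
  have h := sum_update_swap a fun (I : Fin q → Fin m) s =>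
    (∑ i, christoffel G x (I a) i s * w i * v a s) * T x I *
      ∏ b ∈ Finset.univ.erase a, v b (I b)
  have h1 : T.apply x (Function.update v a (christoffelVec G x w (v a))) =
      ∑ I : Fin q → Fin m, ∑ s, (∑ i, christoffel G x (I a) i s * w i * v a s) * T x I *
      ∏ b ∈ Finset.univ.erase a, v b (I b) := by
    simp only [CovTensor.apply, prod_update_apply, christoffelVec]
    refine Finset.sum_congr rfl fun I _ => ?_
    rw [Finset.sum_comm, Finset.sum_mul, Finset.mul_sum]
    refine Finset.sum_congr rfl fun s _ => ?_
    ring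
  rw [h1, ← h, Finset.sum_comm]
  refine Finset.sum_congr rfl fun I _ => ?_
  simp only [Finset.sum_mul]
  rw [Finset.sum_comm]
  refine Finset.sum_congr rfl fun s _ => Finset.sum_congr rfl fun i _ => ?_
  have h2 : ∏ b ∈ Finset.univ.erase a, v b (Function.update I a s b) =
      ∏ b ∈ Finset.univ.erase a, v b (I b) :=
    Finset.prod_congr rfl fun b hb => by rw [Function.update_of_ne (Finset.ne_of_mem_erase hb)]
  rw [Function.update_self, h2, ← Finset.mul_prod_erase _ (fun b => v b (I b)) (Finset.mem_univ a)]
  ring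

/-- Passes from components to the invariant formula `(∇_w T)(v) = w(T(v)) - ∑ T(…, ∇_w v_a, …)`, the
`v_a` being extended with constant coefficients. -/
lemma CovTensor.covDeriv_apply_snoc (G : Coord m → Matrix (Fin m) (Fin m) ℝ)
    (hT : ∀ I, DifferentiableAt ℝ (fun y => T y I) x) (v : Fin q → Coord m) (w : Coord m) :
    (covDeriv G T).apply x (Fin.snoc v w : Fin (q + 1) → Coord m) =
      ∑ i, w i * partialDeriv i (fun y => T.apply y v) x
        - ∑ a, T.apply x (Function.update v a (christoffelVec G x w (v a))) := by
  have hp : ∀ i, partialDeriv i (fun y => T.apply y v) x =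
      ∑ I : Fin q → Fin m, partialDeriv i (fun y => T y I) x * ∏ b, v b (I b) := by
    intro i
    have h : HasFDerivAt (fun y => T.apply y v)
        (∑ I : Fin q → Fin m, (∏ b, v b (I b)) • fderiv ℝ (fun y => T y I) x) x :=
      HasFDerivAt.fun_sum fun I _ => (hT I).hasFDerivAt.mul_const _
    simp only [partialDeriv, h.fderiv, sum_apply,
      smul_apply, smul_eq_mul]
    exact Finset.sum_congr rfl fun I _ => mul_comm _ _
  simp only [hp, ← sum_christoffel_mul T x G v w]
  rw [CovTensor.apply, sum_fin_succ_pi', Finset.sum_comm (s := (Finset.univ : Finset (Fin q))),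
    ← Finset.sum_sub_distrib]
  refine Finset.sum_congr rfl fun i _ => ?_
  rw [Finset.sum_comm, Finset.mul_sum, ← Finset.sum_sub_distrib]
  refine Finset.sum_congr rfl fun I _ => ?_
  rw [Fin.prod_univ_castSucc]
  simp only [covDeriv, Fin.snoc_castSucc, Fin.snoc_last, Fin.init_snoc]
  rw [sub_mul, Finset.sum_mul]
  ring

end Apply

/-! ### The Jacobi operators along a ray -/

/-- The connection matrix along the ray `t ↦ t ξ`: `∇_ξ ∂_j = ∑ s, A_{sj} ∂_s`. -/
def connMat {m : ℕ} (G : Coord m → Matrix (Fin m) (Fin m) ℝ) (ξ : Coord m) (t : ℝ) :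
    Matrix (Fin m) (Fin m) ℝ :=
  Matrix.of fun s j => ∑ i, ξ i * christoffel G (t • ξ) s i j

/-- The matrix of the bilinear form `(∇^k R)(·, ξ, ξ, ·; ξ, …, ξ)` at `x`. -/
def jacobiMat {m : ℕ} (G : Coord m → Matrix (Fin m) (Fin m) ℝ) (x : Coord m) (k : ℕ)
    (ξ : Coord m) : Matrix (Fin m) (Fin m) ℝ :=
  Matrix.of fun i j => jacobiForm G x k ξ (coordVec i) (coordVec j)

section Ray

variable {m : ℕ} {U : Set (Coord m)} {G : Coord m → Matrix (Fin m) (Fin m) ℝ}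

lemma sum_smul_coordVec (ξ : Coord m) : ∑ i, ξ i • coordVec i = ξ := by
  ext j
  simp [coordVec, Finset.sum_apply, Pi.single_apply]

lemma hasDerivAt_comp_ray (hU : IsOpen U) {f : Coord m → ℝ} (hf : ContDiffOn ℝ ∞ f U)
    {ξ : Coord m} {t : ℝ} (ht : t • ξ ∈ U) :
    HasDerivAt (fun s : ℝ => f (s • ξ)) (∑ i, ξ i * partialDeriv i f (t • ξ)) t := by
  have h1 : HasFDerivAt f (fderiv ℝ f (t • ξ)) (t • ξ) :=
    ((hf.contDiffAt (hU.mem_nhds ht)).differentiableAt (by simp)).hasFDerivAt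
  have h2 : HasDerivAt (fun s : ℝ => s • ξ) ξ t := by
    simpa using (hasDerivAt_id t).smul_const ξ
  refine (h1.comp_hasDerivAt t h2).congr_deriv ?_
  conv_lhs => rw [← sum_smul_coordVec ξ, map_sum]
  simp [partialDeriv, sum_smul_coordVec]

lemma isOpen_ray (hU : IsOpen U) (ξ : Coord m) : IsOpen {t : ℝ | t • ξ ∈ U} :=
  hU.preimage (by fun_prop)

lemma contDiffOn_comp_ray {f : Coord m → ℝ} (hf : ContDiffOn ℝ ∞ f U) (ξ : Coord m) :
    ContDiffOn ℝ ∞ (fun t : ℝ => f (t • ξ)) {t : ℝ | t • ξ ∈ U} :=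
  hf.comp (contDiff_id.smul contDiff_const).contDiffOn fun _ ht => ht

lemma IsSmoothMetricOn.isSmoothMat_connMat (h : IsSmoothMetricOn G U) (hU : IsOpen U)
    (ξ : Coord m) : IsSmoothMat {t : ℝ | t • ξ ∈ U} (connMat G ξ) :=
  fun s j => by
    simp only [connMat, Matrix.of_apply]
    exact ContDiffOn.sum fun i _ =>
      contDiffOn_const.mul (contDiffOn_comp_ray (h.contDiffOn_christoffel hU s i j) ξ)

lemma IsSmoothMetricOn.hasMatDerivAt_ray (h : IsSmoothMetricOn G U) (hU : IsOpen U)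
    {ξ : Coord m} {t : ℝ} (ht : t • ξ ∈ U) :
    HasMatDerivAt (fun s => G (s • ξ))
      ((connMat G ξ t).transpose * G (t • ξ) + G (t • ξ) * connMat G ξ t) t := by
  intro j k
  refine (hasDerivAt_comp_ray hU (h.smooth j k) ht).congr_deriv ?_
  simp only [h.partialDeriv_eq ht, Matrix.add_apply, Matrix.mul_apply, Matrix.transpose_apply,
    connMat, Matrix.of_apply, Finset.mul_sum, Finset.sum_mul]
  rw [← Finset.sum_add_distrib, Finset.sum_comm]
  refine Finset.sum_congr rfl fun s _ => ?_
  rw [← Finset.sum_add_distrib]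
  refine Finset.sum_congr rfl fun i _ => ?_
  ring

lemma jacobiForm_eq_sum (x : Coord m) (k : ℕ) (ξ η₁ η₂ : Coord m) :
    jacobiForm G x k ξ η₁ η₂ = ∑ s, η₁ s * jacobiForm G x k ξ (coordVec s) η₂ := by
  have h : ∀ η : Coord m, (fun a : Fin (4 + k) =>
      if (a : ℕ) = 0 then η else if (a : ℕ) = 3 then η₂ else ξ) =
      Function.update (fun a : Fin (4 + k) => if (a : ℕ) = 3 then η₂ else ξ)
        ⟨0, by omega⟩ η := by
    intro η
    ext1 a
    by_cases ha : (a : ℕ) = 0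
    · rw [if_pos ha, show a = ⟨0, by omega⟩ from Fin.ext ha, Function.update_self]
    · rw [if_neg ha, Function.update_of_ne]
      exact fun h => ha (congrArg Fin.val h)
  simp only [jacobiForm, h]
  exact CovTensor.apply_update _ _ _ _ _

lemma jacobiForm_eq_sum' (x : Coord m) (k : ℕ) (ξ η₁ η₂ : Coord m) :
    jacobiForm G x k ξ η₁ η₂ = ∑ s, η₂ s * jacobiForm G x k ξ η₁ (coordVec s) := by
  have h : ∀ η : Coord m, (fun a : Fin (4 + k) =>
      if (a : ℕ) = 0 then η₁ else if (a : ℕ) = 3 then η else ξ) =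
      Function.update (fun a : Fin (4 + k) => if (a : ℕ) = 0 then η₁ else ξ)
        ⟨3, by omega⟩ η := by
    intro η
    ext1 a
    by_cases ha : (a : ℕ) = 3
    · rw [if_neg (by omega), if_pos ha, show a = ⟨3, by omega⟩ from Fin.ext ha,
        Function.update_self]
    · rw [if_neg ha, Function.update_of_ne]
      exact fun h => ha (congrArg Fin.val h)
  simp only [jacobiForm, h]
  exact CovTensor.apply_update _ _ _ _ _

/-- All slots other than 0 and 3 hold `ξ`, and `∇_ξ ξ = 0` removes their correction terms. The new
last slot also holds `ξ`, which makes this a derivative along the ray. -/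
lemma IsSmoothMetricOn.jacobiForm_succ (h : IsSmoothMetricOn G U) (hU : IsOpen U) {x : Coord m}
    (hx : x ∈ U) (k : ℕ) {ξ : Coord m} (hξ : christoffelVec G x ξ ξ = 0) (η₁ η₂ : Coord m) :
    jacobiForm G x (k + 1) ξ η₁ η₂ =
      ∑ i, ξ i * partialDeriv i (fun y => jacobiForm G y k ξ η₁ η₂) x
        - jacobiForm G x k ξ (christoffelVec G x ξ η₁) η₂
        - jacobiForm G x k ξ η₁ (christoffelVec G x ξ η₂) := by
  set v : Fin (4 + k) → Coord m := fun a =>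
    if (a : ℕ) = 0 then η₁ else if (a : ℕ) = 3 then η₂ else ξ with hv
  have hsnoc : (fun a : Fin (4 + (k + 1)) =>
      if (a : ℕ) = 0 then η₁ else if (a : ℕ) = 3 then η₂ else ξ) =
      (Fin.snoc v ξ : Fin (4 + k + 1) → Coord m) := by
    ext1 a
    refine Fin.lastCases (n := 4 + k) ?_ (fun b => ?_) a
    · rw [Fin.snoc_last, Fin.val_last, if_neg (by omega), if_neg (by omega)]
    · rw [Fin.snoc_castSucc]
      rfl
  have h1 : jacobiForm G x (k + 1) ξ η₁ η₂ = (covDeriv G (covDerivCurvature G k)).apply x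
      (Fin.snoc v ξ : Fin (4 + k + 1) → Coord m) := by
    rw [← hsnoc]
    rfl
  rw [h1, CovTensor.covDeriv_apply_snoc _ _ _ fun I =>
    ((h.contDiffOn_covDerivCurvature hU k I).contDiffAt (hU.mem_nhds hx)).differentiableAt
      (by simp), sub_sub]
  congr 1
  have hne : (⟨0, by omega⟩ : Fin (4 + k)) ≠ ⟨3, by omega⟩ := by simp
  rw [← Finset.sum_subset (Finset.subset_univ {⟨0, by omega⟩, ⟨3, by omega⟩}),
    Finset.sum_pair hne]
  · congr 1
    · unfold jacobiForm
      congr 1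
      ext1 a
      by_cases ha : (a : ℕ) = 0
      · rw [if_pos ha, show a = ⟨0, by omega⟩ from Fin.ext ha, Function.update_self]
        rfl
      · rw [if_neg ha, Function.update_of_ne fun h => ha (congrArg Fin.val h), hv]
        simp only [if_neg ha]
    · unfold jacobiForm
      congr 1
      ext1 a
      by_cases ha : (a : ℕ) = 3
      · rw [if_neg (by omega), if_pos ha, show a = ⟨3, by omega⟩ from Fin.ext ha,
          Function.update_self]
        rfl
      · rw [if_neg ha, Function.update_of_ne fun h => ha (congrArg Fin.val h), hv]
        simp only [if_neg ha]
  · intro a _ ha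
    have h0 : (a : ℕ) ≠ 0 := fun h => ha (by simp [Fin.ext_iff, h])
    have h3 : (a : ℕ) ≠ 3 := fun h => ha (by simp [Fin.ext_iff, h])
    have hva : v a = ξ := by simp only [hv, if_neg h0, if_neg h3]
    rw [hva, hξ, CovTensor.apply_update_zero]

lemma christoffelVec_coordVec (ξ : Coord m) (t : ℝ) (i s : Fin m) :
    christoffelVec G (t • ξ) ξ (coordVec i) s = connMat G ξ t s i := by
  simp only [christoffelVec, connMat, Matrix.of_apply]
  refine Finset.sum_congr rfl fun a _ => ?_
  rw [Finset.sum_eq_single i]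
  · simp [coordVec]; ring
  · intro b _ hb; simp [coordVec, hb]
  · simp

lemma IsSmoothMetricOn.jacobiMat_succ (h : IsSmoothMetricOn G U) (hU : IsOpen U) {ξ : Coord m}
    {t : ℝ} (ht : t • ξ ∈ U) (hξ : christoffelVec G (t • ξ) ξ ξ = 0) (k : ℕ) :
    HasMatDerivAt (fun s => jacobiMat G (s • ξ) k ξ)
      (jacobiMat G (t • ξ) (k + 1) ξ + (connMat G ξ t).transpose * jacobiMat G (t • ξ) k ξ
        + jacobiMat G (t • ξ) k ξ * connMat G ξ t) t := by
  intro i j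
  refine (hasDerivAt_comp_ray hU (h.contDiffOn_jacobiForm hU k ξ (coordVec i) (coordVec j))
    ht).congr_deriv ?_
  have h1 := h.jacobiForm_succ hU ht k hξ (coordVec i) (coordVec j)
  rw [jacobiForm_eq_sum _ _ _ (christoffelVec _ _ _ _),
    jacobiForm_eq_sum' _ _ _ _ (christoffelVec _ _ _ _)] at h1
  simp only [christoffelVec_coordVec] at h1
  simp only [Matrix.add_apply, Matrix.mul_apply, Matrix.transpose_apply, jacobiMat,
    Matrix.of_apply, h1, fun s => mul_comm (jacobiForm G (t • ξ) k ξ (coordVec i) (coordVec s))]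
  ring

lemma IsSmoothMetricOn.mul_jacobiOp (h : IsSmoothMetricOn G U) {x : Coord m} (hx : x ∈ U) (k : ℕ)
    (ξ : Coord m) : G x * jacobiOp G x k ξ = (jacobiMat G x k ξ).transpose := by
  rw [jacobiOp, ← mul_assoc, Matrix.mul_nonsing_inv _
    (isUnit_iff_ne_zero.2 (h.det_pos x hx).ne'), one_mul]
  rfl

lemma IsSmoothMetricOn.isSmoothMat_jacobiOp (h : IsSmoothMetricOn G U) (hU : IsOpen U) (k : ℕ)
    (ξ : Coord m) : IsSmoothMat {t : ℝ | t • ξ ∈ U} (fun t => jacobiOp G (t • ξ) k ξ) :=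
  IsSmoothMat.mul (X := fun t => (G (t • ξ))⁻¹)
    (Y := fun t => (jacobiMat G (t • ξ) k ξ).transpose)
    (fun i j => contDiffOn_comp_ray (h.contDiffOn_inv i j) ξ)
    (fun i j => contDiffOn_comp_ray (h.contDiffOn_jacobiForm hU k ξ (coordVec j) (coordVec i)) ξ)

/-- Along a geodesic ray, the Jacobi operator of order `k + 1` is the covariant derivative of the
one of order `k`. -/
lemma IsSmoothMetricOn.hasCovDerivAt_jacobiOp (h : IsSmoothMetricOn G U) (hU : IsOpen U)
    {ξ : Coord m} {t : ℝ} (ht : t • ξ ∈ U) (hξ : christoffelVec G (t • ξ) ξ ξ = 0) (k : ℕ) :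
    HasCovDerivAt (connMat G ξ) (fun s => jacobiOp G (s • ξ) k ξ)
      (jacobiOp G (t • ξ) (k + 1) ξ) t := by
  -- The identity `G J_k = B_kᵀ`, with `B_k` the matrix of the bilinear form, is differentiated in
  -- two ways: by the product rule, where the terms in `G'` come from metric compatibility, and by
  -- the formula for `B_k'`. Cancelling `G` leaves `J_k'`.
  have h1 := (h.isSmoothMat_jacobiOp hU k ξ).hasMatDerivAt (isOpen_ray hU ξ) ht
  have h2 := (h.hasMatDerivAt_ray hU ht).mul h1
  have h3 := (h.jacobiMat_succ hU ht hξ k).transpose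
  have h4 := h2.unique (h3.congr (Filter.mem_of_superset ((isOpen_ray hU ξ).mem_nhds ht)
    fun s hs => h.mul_jacobiOp hs k ξ))
  simp only [Matrix.transpose_add, Matrix.transpose_mul, Matrix.transpose_transpose,
    ← h.mul_jacobiOp ht] at h4
  have h5 : G (t • ξ) * (derivMat (fun s => jacobiOp G (s • ξ) k ξ) t) =
      G (t • ξ) * (jacobiOp G (t • ξ) (k + 1) ξ - connMat G ξ t * jacobiOp G (t • ξ) k ξ
        + jacobiOp G (t • ξ) k ξ * connMat G ξ t) := by
    rw [← sub_eq_zero] at h4 ⊢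
    rw [← h4]
    noncomm_ring
  have h6 := congrArg (fun X => (G (t • ξ))⁻¹ * X) h5
  simp only [← mul_assoc, Matrix.nonsing_inv_mul _
    (isUnit_iff_ne_zero.2 (h.det_pos _ ht).ne'), one_mul] at h6
  unfold HasCovDerivAt
  rwa [← h6]

end Ray

section Riccati

variable {m : ℕ} {U : Set (Coord m)} {G : Coord m → Matrix (Fin m) (Fin m) ℝ}

lemma jacobiForm_zero (x ξ : Coord m) (i j : Fin m) :
    jacobiForm G x 0 ξ (coordVec i) (coordVec j) =
      ∑ l, G x l j * ∑ a, ∑ b, ξ a * ξ b * curvatureOp G x l i a b := by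
  have h : jacobiForm G x 0 ξ (coordVec i) (coordVec j) = ∑ p, ∑ a, ∑ b, ∑ q,
      (∑ l, curvatureOp G x l p a b * G x l q) *
        ((coordVec i : Coord m) p * (ξ a * (ξ b * (coordVec j : Coord m) q))) := by
    unfold jacobiForm CovTensor.apply
    simp only [sum_fin_succ_pi (q := 3), sum_fin_succ_pi (q := 2), sum_fin_succ_pi (q := 1),
      sum_fin_succ_pi (q := 0), Fintype.sum_unique]
    refine Finset.sum_congr rfl fun p _ => Finset.sum_congr rfl fun a _ =>
      Finset.sum_congr rfl fun b _ => Finset.sum_congr rfl fun q _ => ?_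
    congr 1
    exact (Fin.prod_univ_four _).trans (by simp only [mul_assoc]; rfl)
  rw [h, Finset.sum_eq_single i]
  · simp only [Finset.mul_sum]
    conv_rhs => rw [Finset.sum_comm]
    refine Finset.sum_congr rfl fun a _ => ?_
    conv_rhs => rw [Finset.sum_comm]
    refine Finset.sum_congr rfl fun b _ => ?_
    rw [Finset.sum_eq_single j]
    · rw [Finset.sum_mul]
      refine Finset.sum_congr rfl fun l _ => ?_
      simp [coordVec]
      ring
    · intro q _ hq
      simp [coordVec, hq]
    · simp
  · intro p _ hp
    simp [coordVec, hp]
  · simp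

lemma IsSmoothMetricOn.jacobiOp_zero (h : IsSmoothMetricOn G U) {x : Coord m} (hx : x ∈ U)
    (ξ : Coord m) : jacobiOp G x 0 ξ =
      Matrix.of fun l i => ∑ a, ∑ b, ξ a * ξ b * curvatureOp G x l i a b := by
  have h1 : (jacobiMat G x 0 ξ).transpose =
      G x * Matrix.of fun l i => ∑ a, ∑ b, ξ a * ξ b * curvatureOp G x l i a b := by
    ext j i
    simp only [Matrix.transpose_apply, jacobiMat, Matrix.of_apply, jacobiForm_zero,
      Matrix.mul_apply, fun l => h.symm x l j]
  change (G x)⁻¹ * (jacobiMat G x 0 ξ).transpose = _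
  rw [h1, ← mul_assoc, Matrix.nonsing_inv_mul _ (isUnit_iff_ne_zero.2 (h.det_pos x hx).ne'),
    one_mul]

/-- The coordinate rays through the origin are geodesics, within `U`. -/
def IsRadial (G : Coord m → Matrix (Fin m) (Fin m) ℝ) (U : Set (Coord m)) : Prop :=
  ∀ (ξ : Coord m) (t : ℝ), t • ξ ∈ U → christoffelVec G (t • ξ) ξ ξ = 0

/-- Radiality at `t = 1` says that `Γ^l_{ab}(y) y^a y^b` vanishes identically on the open set `U`.
This is its derivative in the direction `∂_i`, the two terms from the factors `y` being equal by
symmetry of `Γ`. -/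
lemma IsSmoothMetricOn.sum_partialDeriv_christoffel (h : IsSmoothMetricOn G U) (hU : IsOpen U)
    (hr : IsRadial G U) {x : Coord m} (hx : x ∈ U) (l i : Fin m) :
    ∑ a, ∑ b, partialDeriv i (fun y => christoffel G y l a b) x * x a * x b
      + 2 * ∑ a, christoffel G x l a i * x a = 0 := by
  have hF : HasFDerivAt (fun y : Coord m => ∑ a, ∑ b, christoffel G y l a b * y a * y b)
      (∑ a, ∑ b, ((christoffel G x l a b * x a) • EuclideanSpace.proj (𝕜 := ℝ) b +
        x b • (christoffel G x l a b • EuclideanSpace.proj (𝕜 := ℝ) a +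
          x a • fderiv ℝ (fun y => christoffel G y l a b) x))) x := by
    refine HasFDerivAt.fun_sum fun a _ => HasFDerivAt.fun_sum fun b _ => ?_
    have hΓ := (((h.contDiffOn_christoffel hU l a b).contDiffAt
      (hU.mem_nhds hx)).differentiableAt (by simp)).hasFDerivAt
    have hp : ∀ a, HasFDerivAt (fun y : Coord m => y a) (EuclideanSpace.proj (𝕜 := ℝ) a) x :=
      fun a => (EuclideanSpace.proj (𝕜 := ℝ) a).hasFDerivAt
    exact (hΓ.mul (hp a)).mul (hp b)
  have h0 : HasFDerivAt (fun y : Coord m => ∑ a, ∑ b, christoffel G y l a b * y a * y b)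
      (0 : Coord m →L[ℝ] ℝ) x := by
    refine (hasFDerivAt_const (0 : ℝ) x).congr_of_eventuallyEq
      (Filter.mem_of_superset (hU.mem_nhds hx) fun y hy => ?_)
    have := hr y 1 (by simpa using hy)
    rw [one_smul] at this
    exact congrFun (congrArg WithLp.ofLp this) l
  have h1 := congrArg (fun L : Coord m →L[ℝ] ℝ => L (coordVec i)) (hF.unique h0)
  have hproj : ∀ a, EuclideanSpace.proj (𝕜 := ℝ) a (coordVec i : Coord m) =
      if a = i then 1 else 0 := by
    intro a
    simp [coordVec]
  simp only [sum_apply, add_apply, smul_apply, smul_eq_mul, hproj, zero_apply, mul_add, mul_ite,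
    mul_one, mul_zero, Finset.sum_add_distrib, Finset.sum_ite_eq', Finset.mem_univ, if_true] at h1
  have h2 : ∑ a, ∑ b, (if a = i then x b * christoffel G x l a b else 0) =
      ∑ a, christoffel G x l a i * x a := by
    rw [Finset.sum_comm]
    simp only [Finset.sum_ite_eq', Finset.mem_univ, if_true]
    refine Finset.sum_congr rfl fun a _ => ?_
    rw [h.christoffel_symm x l i a, mul_comm]
  rw [h2] at h1
  rw [← h1]
  have h3 : ∑ a, ∑ b, partialDeriv i (fun y => christoffel G y l a b) x * x a * x b =
      ∑ a, ∑ b, x b * (x a * (fderiv ℝ (fun y => christoffel G y l a b) x) (coordVec i)) := by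
    refine Finset.sum_congr rfl fun a _ => Finset.sum_congr rfl fun b _ => ?_
    rw [partialDeriv]
    ring
  rw [h3]
  ring

/-- Every direction `ξ` is radial at the origin, so polarization applies. -/
lemma IsSmoothMetricOn.christoffel_origin (h : IsSmoothMetricOn G U) (hr : IsRadial G U)
    (h0 : (0 : Coord m) ∈ U) (l i j : Fin m) : christoffel G 0 l i j = 0 := by
  refine eq_zero_of_quadratic_eq_zero (c := christoffel G 0 l) (h.christoffel_symm 0 l)
    (fun ξ => ?_) i j
  have := hr ξ 0 (by simpa using h0)
  rw [zero_smul] at this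
  exact congrFun (congrArg WithLp.ofLp this) l

/-- The Riccati equation for the connection matrix along a geodesic ray. -/
lemma IsSmoothMetricOn.riccati (h : IsSmoothMetricOn G U) (hU : IsOpen U) (hr : IsRadial G U)
    {ξ : Coord m} {t : ℝ} (ht : t • ξ ∈ U) :
    t • derivMat (connMat G ξ) t + (2 : ℝ) • connMat G ξ t
      + t • (connMat G ξ t * connMat G ξ t) + t • jacobiOp G (t • ξ) 0 ξ = 0 := by
  have hsymm := h.christoffel_symm (t • ξ)
  have hA : ∀ l i, connMat G ξ t l i = ∑ b, ξ b * christoffel G (t • ξ) l i b := fun l i => by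
    simp only [connMat, Matrix.of_apply, hsymm l i]
  -- The derivative of the geodesic identity at `x = t ξ` is `t` times this equation. For `t = 0`,
  -- where `t` cannot be cancelled, the Christoffel symbols vanish.
  have h1 : ∀ l i, t * ∑ a, ∑ b, ξ a * ξ b *
      partialDeriv i (fun y => christoffel G y l a b) (t • ξ) + 2 * connMat G ξ t l i = 0 := by
    intro l i
    by_cases ht0 : t = 0
    · subst ht0
      have h0 : (0 : Coord m) ∈ U := by simpa using ht
      simp [connMat, h.christoffel_origin hr h0]
    · have := h.sum_partialDeriv_christoffel hU hr ht l i
      refine mul_left_cancel₀ ht0 ?_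
      rw [mul_zero, ← this, hA]
      simp only [mul_add, Finset.mul_sum, PiLp.smul_apply, smul_eq_mul, hsymm l i]
      congr 1
      · refine Finset.sum_congr rfl fun a _ => Finset.sum_congr rfl fun b _ => ?_
        ring
      · refine Finset.sum_congr rfl fun a _ => ?_
        ring
  have h2 : ∀ l i, derivMat (connMat G ξ) t l i = ∑ a, ∑ b, ξ a * ξ b *
      partialDeriv a (fun y => christoffel G y l i b) (t • ξ) := by
    intro l i
    have h3 : HasDerivAt (fun s => connMat G ξ s l i) (∑ b, ξ b * ∑ a, ξ a *
        partialDeriv a (fun y => christoffel G y l b i) (t • ξ)) t := by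
      simp only [connMat, Matrix.of_apply]
      exact HasDerivAt.fun_sum fun b _ =>
        (hasDerivAt_comp_ray hU (h.contDiffOn_christoffel hU l b i) ht).const_mul _
    rw [derivMat, Matrix.of_apply, h3.deriv, Finset.sum_comm]
    refine Finset.sum_congr rfl fun b _ => ?_
    rw [Finset.mul_sum]
    refine Finset.sum_congr rfl fun a _ => ?_
    simp only [fun y => h.christoffel_symm y l i b]
    ring
  -- Of the two quadratic terms of the curvature, the first contains `Γ(ξ, ξ) = 0` and the second is
  -- `-A²`. Hence `J_0 = ∑ ξ^a ξ^b ∂_i Γ_{ab} - A' - A²`, and `h1` evaluates the first sum after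
  -- multiplication by `t`.
  have h4 : ∀ l i, ∑ a, ∑ b, ξ a * ξ b * (∑ s, (christoffel G (t • ξ) l i s *
      christoffel G (t • ξ) s a b - christoffel G (t • ξ) l a s * christoffel G (t • ξ) s i b)) =
      -(connMat G ξ t * connMat G ξ t) l i := by
    intro l i
    have h5 : ∀ s, ∑ a, ∑ b, christoffel G (t • ξ) s a b * ξ a * ξ b = 0 := fun s =>
      congrFun (congrArg WithLp.ofLp (hr ξ t ht)) s
    have h6 : ∑ a, ∑ b, ξ a * ξ b * (∑ s, (christoffel G (t • ξ) l i s *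
        christoffel G (t • ξ) s a b - christoffel G (t • ξ) l a s *
          christoffel G (t • ξ) s i b)) =
        ∑ s, christoffel G (t • ξ) l i s * (∑ a, ∑ b, christoffel G (t • ξ) s a b * ξ a * ξ b) -
        ∑ s, (∑ a, ξ a * christoffel G (t • ξ) l a s) *
          ∑ b, ξ b * christoffel G (t • ξ) s i b := by
      have h7 : ∀ s, christoffel G (t • ξ) l i s *
          (∑ a, ∑ b, christoffel G (t • ξ) s a b * ξ a * ξ b) -
          (∑ a, ξ a * christoffel G (t • ξ) l a s) * ∑ b, ξ b * christoffel G (t • ξ) s i b =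
          ∑ a, ∑ b, ξ a * ξ b * (christoffel G (t • ξ) l i s * christoffel G (t • ξ) s a b -
            christoffel G (t • ξ) l a s * christoffel G (t • ξ) s i b) := by
        intro s
        rw [Finset.sum_mul_sum, Finset.mul_sum, ← Finset.sum_sub_distrib]
        refine Finset.sum_congr rfl fun a _ => ?_
        rw [Finset.mul_sum, ← Finset.sum_sub_distrib]
        refine Finset.sum_congr rfl fun b _ => ?_
        ring
      rw [← Finset.sum_sub_distrib]
      simp only [h7]
      conv_rhs => rw [Finset.sum_comm]
      refine Finset.sum_congr rfl fun a _ => ?_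
      conv_rhs => rw [Finset.sum_comm]
      refine Finset.sum_congr rfl fun b _ => ?_
      rw [Finset.mul_sum]
    rw [h6]
    simp only [h5, mul_zero, Finset.sum_const_zero, zero_sub, Matrix.mul_apply]
    congr 1
    refine Finset.sum_congr rfl fun s _ => ?_
    rw [hA s i]
    rfl
  ext l i
  rw [h.jacobiOp_zero ht]
  simp only [Matrix.add_apply, Matrix.smul_apply, Matrix.of_apply, Matrix.zero_apply, smul_eq_mul,
    curvatureOp, mul_add, mul_sub, Finset.sum_add_distrib, Finset.sum_sub_distrib, h2]
  have h7 := h4 l i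
  simp only [mul_sub, Finset.sum_sub_distrib] at h7
  linear_combination h1 l i + t * h7

end Riccati

section RayData

variable {m : ℕ} {U : Set (Coord m)} {G : Coord m → Matrix (Fin m) (Fin m) ℝ}

/-- The Taylor coefficients at the origin of the Jacobi operators, the connection matrix and the
density along the geodesic ray in direction `ξ`. -/
def rayData (h : IsSmoothMetricOn G U) (hU : IsOpen U) (h0 : (0 : Coord m) ∈ U)
    (hr : IsRadial G U) (hG : G 0 = 1) (ξ : Coord m) : RadialData :=
  have key := radial_recurrences (isOpen_ray hU ξ) (by simpa using h0)
    (h.isSmoothMat_connMat hU ξ) (J := fun k t => jacobiOp G (t • ξ) k ξ)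
    (fun k t ht => h.hasCovDerivAt_jacobiOp hU ht (hr ξ t ht) k)
    (fun t ht => h.riccati hU hr ht) (θ := fun t => √((G (t • ξ)).det))
    ((contDiffOn_comp_ray (contDiffOn_det h.smooth) ξ).sqrt fun t ht => (h.det_pos _ ht).ne')
    (by simp [hG])
    (fun t ht => hasDerivAt_sqrt_det (h.hasMatDerivAt_ray hU ht) (h.det_pos _ ht))
  { m := m
    J := fun k => jacobiOp G 0 k ξ
    A := fun k => (k.factorial : ℝ)⁻¹ • ((covD (connMat G ξ))^[k] (connMat G ξ)) 0
    θ := fun n => (n.factorial : ℝ)⁻¹ * iteratedDeriv n (fun t : ℝ => √((G (t • ξ)).det)) 0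
    A_zero := key.1
    A_succ := by simpa only [zero_smul] using key.2.1
    θ_zero := key.2.2.1
    θ_succ := key.2.2.2 }

end RayData

/-! ### Metric coefficients in a chart; geodesic coordinates. -/

section Manifold

open Bundle

lemma ContinuousLinearMap.apply_eq_sum_coordVec {m : ℕ} {E : Type*} [AddCommGroup E] [Module ℝ E]
    [TopologicalSpace E] (L : Coord m →L[ℝ] E) (v : Coord m) :
    L v = ∑ i, v i • L (coordVec i) := by
  conv_lhs => rw [← sum_smul_coordVec v, map_sum]
  simp

lemma mdifferentiable_of_mem_maximalAtlas {m : ℕ}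
    {M : Type*} [TopologicalSpace M] [ChartedSpace (Coord m) M]
    {φ : OpenPartialHomeomorph M (Coord m)}
    (hφ : φ ∈ IsManifold.maximalAtlas 𝓘(ℝ, Coord m) ∞ M) :
    φ.MDifferentiable 𝓘(ℝ, Coord m) 𝓘(ℝ, Coord m) :=
  ⟨(contMDiffOn_of_mem_maximalAtlas hφ).mdifferentiableOn (by simp),
    (contMDiffOn_symm_of_mem_maximalAtlas hφ).mdifferentiableOn (by simp)⟩

variable {m : ℕ} {M : Type*} [TopologicalSpace M] [ChartedSpace (Coord m) M]
  [IsManifold 𝓘(ℝ, Coord m) ∞ M]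
  (g : Bundle.ContMDiffRiemannianMetric 𝓘(ℝ, Coord m) ∞ (Coord m)
      (fun p : M => TangentSpace 𝓘(ℝ, Coord m) p))
  {φ : OpenPartialHomeomorph M (Coord m)}

lemma metricCoeff_symm (x : Coord m) (i j : Fin m) :
    metricCoeff g φ x i j = metricCoeff g φ x j i :=
  g.symm _ _ _

/-- The coefficients form the Gram matrix of the images of the `∂_i` under the differential of
`φ.symm`, which is injective because the differential of `φ` is a left inverse. -/
lemma metricCoeff_det_pos (hφ : φ ∈ IsManifold.maximalAtlas 𝓘(ℝ, Coord m) ∞ M)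
    {x : Coord m} (hx : x ∈ φ.target) : 0 < (metricCoeff g φ x).det := by
  refine Matrix.PosDef.det_pos (Matrix.PosDef.of_dotProduct_mulVec_pos ?_ fun v hv => ?_)
  · ext i j
    exact metricCoeff_symm g x j i
  · set L := mfderiv 𝓘(ℝ, Coord m) 𝓘(ℝ, Coord m) φ.symm x
    have hL : L (WithLp.toLp 2 v) ≠ 0 := by
      intro h0
      have h1 := congrArg (fun f => f (WithLp.toLp 2 v))
        ((mdifferentiable_of_mem_maximalAtlas hφ).comp_symm_deriv hx)
      have h2 : (WithLp.toLp 2 v : Coord m) = 0 := by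
        refine Eq.trans (Eq.symm h1) ?_
        change mfderiv 𝓘(ℝ, Coord m) 𝓘(ℝ, Coord m) φ (φ.symm x) (L (WithLp.toLp 2 v)) = 0
        rw [h0, map_zero]
      exact hv (by simpa using h2)
    refine (g.pos _ _ hL).trans_eq ?_
    have hLv : L (WithLp.toLp 2 v) = ∑ i, v i • L (coordVec i) :=
      ContinuousLinearMap.apply_eq_sum_coordVec (E := TangentSpace 𝓘(ℝ, Coord m) (φ.symm x)) L _
    rw [hLv]
    simp only [map_sum, map_smul, sum_apply, smul_apply, smul_eq_mul, dotProduct, Matrix.mulVec,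
      metricCoeff, Matrix.of_apply, star_trivial, Finset.mul_sum]
    rw [Finset.sum_comm]
    refine Finset.sum_congr rfl fun i _ => Finset.sum_congr rfl fun j _ => ?_
    ring

/-- The metric pulled back by `φ.symm` is applied to the coordinate fields, which are smooth as
images of constant fields under the tangent map of `φ.symm`. -/
lemma contDiffOn_metricCoeff (hφ : φ ∈ IsManifold.maximalAtlas 𝓘(ℝ, Coord m) ∞ M) (i j : Fin m) :
    ContDiffOn ℝ ∞ (fun x => metricCoeff g φ x i j) φ.target := by
  have hsec : ∀ v : Coord m, ContMDiffOn 𝓘(ℝ, Coord m) (𝓘(ℝ, Coord m).prod 𝓘(ℝ, Coord m)) ∞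
      (fun x => (⟨φ.symm x, mfderiv 𝓘(ℝ, Coord m) 𝓘(ℝ, Coord m) φ.symm x v⟩ :
        TotalSpace (Coord m) (fun p : M => TangentSpace 𝓘(ℝ, Coord m) p))) φ.target := by
    intro v
    have h1 := (contMDiffOn_symm_of_mem_maximalAtlas hφ).contMDiffOn_tangentMapWithin
      (m := ∞) (by simp) φ.open_target.uniqueMDiffOn
    have h2 : ContMDiff 𝓘(ℝ, Coord m) (𝓘(ℝ, Coord m).prod 𝓘(ℝ, Coord m)) ∞
      (fun x => (⟨x, v⟩ : TangentBundle 𝓘(ℝ, Coord m) (Coord m))) := by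
      exact contMDiff_vectorSpace_iff_contDiff.2 contDiff_const
    have h3 := h1.comp h2.contMDiffOn (s := φ.target) (fun x hx => hx)
    refine h3.congr fun x hx => ?_
    simp only [Function.comp, tangentMapWithin]
    rw [mfderivWithin_of_isOpen φ.open_target hx]
  rw [← contMDiffOn_iff_contDiffOn]
  intro x hx
  have hg : ContMDiffWithinAt 𝓘(ℝ, Coord m) (𝓘(ℝ, Coord m).prod
      𝓘(ℝ, Coord m →L[ℝ] Coord m →L[ℝ] ℝ)) ∞
      (fun x => TotalSpace.mk' (Coord m →L[ℝ] Coord m →L[ℝ] ℝ)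
        (E := fun p : M => TangentSpace 𝓘(ℝ, Coord m) p →L[ℝ] TangentSpace 𝓘(ℝ, Coord m) p →L[ℝ] ℝ)
        (φ.symm x) (g.inner (φ.symm x))) φ.target x :=
    g.contMDiff.contMDiffAt.comp_contMDiffWithinAt x
      (contMDiffOn_symm_of_mem_maximalAtlas hφ x hx)
  have h := ContMDiffWithinAt.clm_bundle_apply₂ (F₁ := Coord m) (F₂ := Coord m) (F₃ := ℝ)
    (E₃ := Bundle.Trivial M ℝ) hg (hsec (coordVec i) x hx) (hsec (coordVec j) x hx)
  simp only [contMDiffWithinAt_totalSpace] at h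
  exact h.2

lemma christoffelVec_smul_smul (G : Coord m → Matrix (Fin m) (Fin m) ℝ) (x ξ : Coord m) (c : ℝ) :
    christoffelVec G x (c • ξ) (c • ξ) = c ^ 2 • christoffelVec G x ξ ξ := by
  ext s
  simp only [christoffelVec, PiLp.smul_apply, smul_eq_mul, Finset.mul_sum]
  refine Finset.sum_congr rfl fun i _ => Finset.sum_congr rfl fun j _ => ?_
  ring

variable {g} {P : M}

/-- In geodesic coordinates the metric is smooth near the origin, where it is the identity, and the
coordinate rays are geodesics. -/
lemma IsGeodesicCoordinates.exists_ball (h : IsGeodesicCoordinates g P φ) :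
    ∃ ρ > 0, IsSmoothMetricOn (metricCoeff g φ) (Metric.ball 0 ρ) ∧
      IsRadial (metricCoeff g φ) (Metric.ball 0 ρ) ∧ metricCoeff g φ 0 = 1 := by
  obtain ⟨ρ, hρ, hsub, hgeo⟩ := h.geodesic
  have hderiv : ∀ ξ : Coord m, deriv (fun t : ℝ => t • ξ) = fun _ => ξ := by
    intro ξ
    ext1 t
    simpa using ((hasDerivAt_id t).smul_const ξ).deriv
  have hunit : ∀ ξ : Coord m, ξ ≠ 0 → ‖‖ξ‖⁻¹ • ξ‖ = 1 := fun ξ hξ => norm_smul_inv_norm hξ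
  refine ⟨ρ, hρ, ⟨fun i j => (contDiffOn_metricCoeff g h.mem_maximalAtlas i j).mono hsub,
    metricCoeff_symm g, fun x hx => metricCoeff_det_pos g h.mem_maximalAtlas (hsub hx)⟩, ?_, ?_⟩
  · intro ξ t ht
    by_cases hξ : ξ = 0
    · subst hξ
      ext s
      simp [christoffelVec]
    · have hn : ‖ξ‖ ≠ 0 := norm_ne_zero_iff.2 hξ
      have hs : ‖ξ‖ * t ∈ Set.Ioo (-ρ) ρ := by
        rw [Set.mem_Ioo, ← abs_lt, abs_mul, abs_norm, mul_comm]
        simpa [norm_smul] using ht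
      have h1 := ((hgeo _ (hunit ξ hξ)).2 _ hs).1
      have h2 : (‖ξ‖ * t) • ‖ξ‖⁻¹ • ξ = t • ξ := by
        rw [smul_smul]
        congr 1
        field_simp
      simp only [hderiv, deriv_const, h2, PiLp.zero_apply, zero_add] at h1
      -- The geodesic condition concerns unit vectors only. It is quadratic in the velocity, so it
      -- extends to every nonzero `ξ` by scaling.
      have h3 : christoffelVec (metricCoeff g φ) (t • ξ) (‖ξ‖⁻¹ • ξ) (‖ξ‖⁻¹ • ξ) = 0 := by
        ext s
        exact h1 s
      rw [christoffelVec_smul_smul] at h3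
      exact (smul_eq_zero.1 h3).resolve_left (by positivity)
  -- Unit speed at `t = 0` gives the quadratic form of the metric at the origin; polarization then
  -- gives the matrix.
  · have h0 : ∀ ξ : Coord m, ∑ i, ∑ j, metricCoeff g φ 0 i j * ξ i * ξ j = ‖ξ‖ ^ 2 := by
      intro ξ
      by_cases hξ : ξ = 0
      · subst hξ
        simp
      · have hn : ‖ξ‖ ≠ 0 := norm_ne_zero_iff.2 hξ
        have h1 := ((hgeo _ (hunit ξ hξ)).2 0 ⟨by linarith, hρ⟩).2
        simp only [hderiv, zero_smul, PiLp.smul_apply, smul_eq_mul] at h1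
        have h2 : ∑ i, ∑ j, metricCoeff g φ 0 i j * ξ i * ξ j = ‖ξ‖ ^ 2 *
            ∑ i, ∑ j, metricCoeff g φ 0 i j * (‖ξ‖⁻¹ * ξ i) * (‖ξ‖⁻¹ * ξ j) := by
          simp only [Finset.mul_sum]
          refine Finset.sum_congr rfl fun i _ => Finset.sum_congr rfl fun j _ => ?_
          field_simp
        rw [h2, h1, mul_one]
    rw [← sub_eq_zero]
    ext i j
    refine eq_zero_of_quadratic_eq_zero (c := fun i j => (metricCoeff g φ 0 - 1) i j)
      (fun i j => ?_) (fun ξ => ?_) i j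
    · simp only [Matrix.sub_apply, metricCoeff_symm g 0 i j, Matrix.one_apply, eq_comm]
    · simp only [Matrix.sub_apply, sub_mul, Finset.sum_sub_distrib, h0, Matrix.one_apply, ite_mul,
        one_mul, zero_mul, Finset.sum_ite_eq, Finset.mem_univ, if_true, EuclideanSpace.norm_sq_eq,
        Real.norm_eq_abs, sq_abs]
      simp [pow_two]

end Manifold

/-! ### Taylor expansion along rays. -/

section Taylor

variable {E : Type*} [NormedAddCommGroup E] [NormedSpace ℝ E] {f : E → ℝ} {U : Set E}

/-- Multilinearity of the right side is what makes the `k`-th Taylor coefficient along rays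
homogeneous of degree `k` in `ξ`. -/
lemma iteratedDeriv_comp_ray (hU : IsOpen U) (hf : ContDiffOn ℝ ∞ f U) (k : ℕ) (ξ : E) :
    ∀ t : ℝ, t • ξ ∈ U → iteratedDeriv k (fun s : ℝ => f (s • ξ)) t =
      iteratedFDeriv ℝ k f (t • ξ) (fun _ => ξ) := by
  induction k with
  | zero => simp
  | succ k ih =>
    intro t ht
    have hcont : Continuous fun s : ℝ => s • ξ := by fun_prop
    have h1 : iteratedDeriv k (fun s : ℝ => f (s • ξ)) =ᶠ[𝓝 t]
        fun s => iteratedFDeriv ℝ k f (0 + s • ξ) (fun _ => ξ) :=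
      Filter.mem_of_superset ((hU.preimage hcont).mem_nhds ht) fun s hs => by
        simpa using ih s hs
    rw [iteratedDeriv_succ, h1.deriv_eq, ContDiffAt.deriv_fderiv_add_smul, zero_add]
    rw [zero_add]
    exact (hf.contDiffAt (hU.mem_nhds ht)).of_le (mod_cast le_top)

/-- The Taylor expansion at the origin, in terms of the derivatives along rays. -/
lemma isLittleO_sub_sum_iteratedDeriv_ray {ρ : ℝ} (hρ : 0 < ρ)
    (hf : ContDiffOn ℝ ∞ f (Metric.ball 0 ρ)) (N : ℕ) :
    (fun ξ => f ξ - ∑ k ∈ Finset.range (N + 1),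
      (k.factorial : ℝ)⁻¹ * iteratedDeriv k (fun s : ℝ => f (s • ξ)) 0)
      =o[𝓝 0] fun ξ => ‖ξ‖ ^ N := by
  have h0 : (0 : E) ∈ Metric.ball (0 : E) ρ := by simpa using hρ
  have hsmooth : ∀ x ∈ Metric.ball (0 : E) ρ, ContDiffAt ℝ ∞ f x := fun x hx =>
    hf.contDiffAt (Metric.isOpen_ball.mem_nhds hx)
  have hc : ContinuousAt (iteratedFDeriv ℝ (N + 1) f) 0 :=
    (hsmooth 0 h0).continuousAt_iteratedFDeriv (mod_cast le_top)
  -- By continuity, `C` bounds the derivative of order `N + 1` near the origin, and so the integral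
  -- remainder is at most `C ‖ξ‖^(N+1)`.
  set C := ‖iteratedFDeriv ℝ (N + 1) f 0‖ + 1 with hC
  obtain ⟨r, hr, hball⟩ := Metric.eventually_nhds_iff_ball.1
    (hc.norm.eventually_lt_const (show ‖iteratedFDeriv ℝ (N + 1) f 0‖ < C by linarith))
  have hbig : (fun ξ => f ξ - ∑ k ∈ Finset.range (N + 1),
      (k.factorial : ℝ)⁻¹ * iteratedDeriv k (fun s : ℝ => f (s • ξ)) 0)
      =O[𝓝 0] fun ξ => ‖ξ‖ ^ (N + 1) := by
    refine Asymptotics.IsBigO.of_bound C ?_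
    filter_upwards [Metric.ball_mem_nhds (0 : E) hr, Metric.ball_mem_nhds (0 : E) hρ] with ξ h1 h2
    have hseg : ∀ (R : ℝ), ξ ∈ Metric.ball (0 : E) R → ∀ t ∈ Set.Icc (0 : ℝ) 1,
        t • ξ ∈ Metric.ball (0 : E) R := by
      intro R hR t ht
      rw [mem_ball_zero_iff] at hR ⊢
      rw [norm_smul, Real.norm_of_nonneg ht.1]
      nlinarith [ht.2, norm_nonneg ξ]
    have hT := map_add_eq_sum_add_integral_iteratedFDeriv (f := f) (x := 0) (y := ξ) (n := N)
      (fun t ht => by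
        rw [zero_add]
        exact (hsmooth _ (hseg ρ h2 t ht)).of_le (mod_cast le_top))
    simp only [zero_add] at hT
    have hI : ‖∫ t in (0 : ℝ)..1, (1 - t) ^ N •
        iteratedFDeriv ℝ (N + 1) f (t • ξ) (fun _ => ξ)‖ ≤ C * ‖ξ‖ ^ (N + 1) * |1 - 0| := by
      refine intervalIntegral.norm_integral_le_of_norm_le_const fun t ht => ?_
      rw [Set.uIoc_of_le zero_le_one] at ht
      have ht' : t ∈ Set.Icc (0 : ℝ) 1 := ⟨ht.1.le, ht.2⟩
      have h3 : ‖iteratedFDeriv ℝ (N + 1) f (t • ξ) (fun _ => ξ)‖ ≤ C * ‖ξ‖ ^ (N + 1) := by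
        refine (ContinuousMultilinearMap.le_opNorm _ _).trans ?_
        simp only [Finset.prod_const, Finset.card_univ, Fintype.card_fin]
        gcongr
        exact (hball _ (hseg r h1 t ht')).le
      have h4 : ‖(1 - t) ^ N‖ ≤ 1 := by
        rw [norm_pow, Real.norm_of_nonneg (by linarith [ht.2])]
        exact pow_le_one₀ (by linarith [ht.2]) (by linarith [ht.1])
      rw [norm_smul]
      calc _ ≤ 1 * (C * ‖ξ‖ ^ (N + 1)) := by gcongr
        _ = _ := one_mul _
    have hsum : ∑ k ∈ Finset.range (N + 1),
        (k.factorial : ℝ)⁻¹ * iteratedDeriv k (fun s : ℝ => f (s • ξ)) 0 =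
        ∑ k ∈ Finset.range (N + 1),
          (k.factorial : ℝ)⁻¹ • iteratedFDeriv ℝ k f 0 (fun _ => ξ) := by
      refine Finset.sum_congr rfl fun k _ => ?_
      rw [iteratedDeriv_comp_ray Metric.isOpen_ball hf k ξ 0 (by simpa using hρ), zero_smul,
        smul_eq_mul]
    rw [hsum, hT, add_sub_cancel_left, norm_smul, norm_pow, norm_norm]
    have h5 : ‖(N.factorial : ℝ)⁻¹‖ ≤ 1 := by
      rw [norm_inv, Real.norm_natCast]
      exact inv_le_one_of_one_le₀ (mod_cast Nat.succ_le_of_lt N.factorial_pos)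
    calc _ ≤ 1 * (C * ‖ξ‖ ^ (N + 1) * |1 - 0|) := by gcongr
      _ = _ := by simp
  refine hbig.trans_isLittleO ?_
  simp only [pow_succ]
  have h1 : (fun ξ : E => ‖ξ‖) =o[𝓝 0] fun _ => (1 : ℝ) := by
    rw [Asymptotics.isLittleO_one_iff]
    exact tendsto_norm_zero
  simpa using (Asymptotics.isBigO_refl (fun ξ : E => ‖ξ‖ ^ N) (𝓝 0)).mul_isLittleO h1

end Taylor

/-! ### Existence and uniqueness of the density expansion; the leading coefficient. -/

section Expansion

variable {m : ℕ}

/-- A homogeneous function which is negligible compared to its degree vanishes. -/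
lemma eq_zero_of_homogeneous_of_isLittleO {D : Coord m → ℝ} {k d : ℕ} (hk : k ≠ 0)
    (hD : ∀ (c : ℝ) (ξ : Coord m), D (c • ξ) = c ^ k * D ξ)
    (ho : (fun ξ : Coord m => ‖ξ‖ ^ d * D ξ) =o[𝓝 0] fun ξ => ‖ξ‖ ^ (d + k)) (ξ : Coord m) :
    D ξ = 0 := by
  by_cases hξ : ξ = 0
  · subst hξ
    have := hD 0 0
    rwa [zero_smul, zero_pow hk, zero_mul] at this
  · have hn : 0 < ‖ξ‖ := norm_pos_iff.2 hξ
    have hlim : Filter.Tendsto (fun t : ℝ => t • ξ) (𝓝[>] 0) (𝓝 0) := by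
      have : Filter.Tendsto (fun t : ℝ => t • ξ) (𝓝 0) (𝓝 ((0 : ℝ) • ξ)) :=
        (by fun_prop : Continuous fun t : ℝ => t • ξ).tendsto 0
      rw [zero_smul] at this
      exact this.mono_left nhdsWithin_le_nhds
    by_contra hne
    -- At `t ξ` both sides scale by `t^(d+k)`, so half of the ratio that homogeneity keeps constant
    -- along the ray is already a contradictory bound.
    have h1 := (ho.comp_tendsto hlim).def (c := |D ξ| / ‖ξ‖ ^ k / 2) (by positivity)
    obtain ⟨t, ht, ht0⟩ := (h1.and self_mem_nhdsWithin).exists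
    have ht0' : (0 : ℝ) < t := ht0
    simp only [Function.comp, hD, norm_mul, norm_pow, norm_smul, mul_pow, pow_add,
      Real.norm_eq_abs, abs_of_pos ht0', abs_of_pos hn] at ht
    have h2 : |D ξ| / ‖ξ‖ ^ k / 2 * (t ^ d * ‖ξ‖ ^ d * (t ^ k * ‖ξ‖ ^ k)) =
        (t ^ d * ‖ξ‖ ^ d * (t ^ k * |D ξ|)) / 2 := by
      field_simp
    rw [h2] at ht
    have h3 : 0 < t ^ d * ‖ξ‖ ^ d * (t ^ k * |D ξ|) := by positivity
    linarith

variable {M : Type*} [TopologicalSpace M] [ChartedSpace (Coord m) M]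
  [IsManifold 𝓘(ℝ, Coord m) ∞ M]
  {g : Bundle.ContMDiffRiemannianMetric 𝓘(ℝ, Coord m) ∞ (Coord m)
      (fun p : M => TangentSpace 𝓘(ℝ, Coord m) p)}
  {φ : OpenPartialHomeomorph M (Coord m)}

/-- If the terms below `k` agree, the two expansions truncated at `k` differ only by `‖ξ‖^(m-1) (H k
ξ - H' k ξ)`, which is negligible. -/
lemma IsDensityExpansion.unique {H H' : ℕ → Coord m → ℝ} (h : IsDensityExpansion g φ H)
    (h' : IsDensityExpansion g φ H') {k : ℕ} (hk : 2 ≤ k) (ξ : Coord m) : H k ξ = H' k ξ := by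
  induction k using Nat.strong_induction_on generalizing ξ with
  | _ k ih =>
    rw [← sub_eq_zero]
    refine eq_zero_of_homogeneous_of_isLittleO (D := fun ξ => H k ξ - H' k ξ) (k := k)
      (d := m - 1) (by omega)
      (fun c ξ => by simp only [h.1 k hk, h'.1 k hk]; ring) ?_ ξ
    refine ((h'.2 k).sub (h.2 k)).congr_left fun ξ => ?_
    obtain ⟨j, rfl⟩ : ∃ j, k = j + 1 := ⟨k - 1, by omega⟩
    have hs : ∑ i ∈ Finset.Icc 2 j, H i ξ = ∑ i ∈ Finset.Icc 2 j, H' i ξ :=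
      Finset.sum_congr rfl fun i hi => by
        rw [Finset.mem_Icc] at hi
        exact ih i (by omega) hi.1 ξ
    rw [Finset.sum_Icc_succ_top hk, Finset.sum_Icc_succ_top hk, hs]
    ring

/-- The Taylor coefficients of the density in geodesic coordinates, along rays. -/
def densityCoeff (G : Coord m → Matrix (Fin m) (Fin m) ℝ) (k : ℕ) (ξ : Coord m) : ℝ :=
  (k.factorial : ℝ)⁻¹ * iteratedDeriv k (fun t : ℝ => √((G (t • ξ)).det)) 0

lemma IsGeodesicCoordinates.isDensityExpansion {P : M} (h : IsGeodesicCoordinates g P φ) :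
    IsDensityExpansion g φ (densityCoeff (metricCoeff g φ)) := by
  obtain ⟨ρ, hρ, hG, hr, hG0⟩ := h.exists_ball
  have h0 : (0 : Coord m) ∈ Metric.ball (0 : Coord m) ρ := by simpa using hρ
  have hsm : ContDiffOn ℝ ∞ (fun x => √((metricCoeff g φ x).det)) (Metric.ball 0 ρ) :=
    (contDiffOn_det hG.smooth).sqrt fun x hx => (hG.det_pos x hx).ne'
  refine ⟨fun k _ c ξ => ?_, fun N => ?_⟩
  · have hray := fun ξ : Coord m => iteratedDeriv_comp_ray Metric.isOpen_ball hsm k ξ 0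
      (by simpa using hρ)
    unfold densityCoeff
    rw [hray, hray]
    simp only [zero_smul]
    rw [ContinuousMultilinearMap.map_smul_univ]
    simp only [Finset.prod_const, Finset.card_univ, Fintype.card_fin, smul_eq_mul]
    ring
  · have hcoef : ∀ ξ, densityCoeff (metricCoeff g φ) 0 ξ = 1 ∧
        densityCoeff (metricCoeff g φ) 1 ξ = 0 := by
      intro ξ
      set d := rayData hG Metric.isOpen_ball h0 hr hG0 ξ with hd
      -- `θ_1 = Tr(A_0) θ_0` and `A_0 = 0`, which is why the expansion has no linear term.
      have h1 : d.θ 1 = 0 := by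
        have := d.θ_succ 0
        simpa [d.A_zero] using this
      exact ⟨d.θ_zero, h1⟩
    have hsum : ∀ ξ, ∑ k ∈ Finset.range (N + 1), densityCoeff (metricCoeff g φ) k ξ =
        1 + ∑ k ∈ Finset.Icc 2 N, densityCoeff (metricCoeff g φ) k ξ := by
      intro ξ
      obtain _ | N := N
      · simp [(hcoef ξ).1]
      · rw [Finset.sum_range_succ', Finset.sum_range_succ', (hcoef ξ).1, (hcoef ξ).2,
          Finset.range_eq_Ico,
          Finset.sum_Ico_add' (fun k => densityCoeff (metricCoeff g φ) k ξ) 0 N 2,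
          add_zero, add_comm]
        congr 1
    have hT := isLittleO_sub_sum_iteratedDeriv_ray hρ hsm N
    refine ((Asymptotics.isBigO_refl (fun ξ : Coord m => ‖ξ‖ ^ (m - 1)) (𝓝 0)).mul_isLittleO
      hT).congr (fun ξ => ?_) (fun ξ => (pow_add _ _ _).symm)
    change ‖ξ‖ ^ (m - 1) * (√((metricCoeff g φ ξ).det) -
      ∑ k ∈ Finset.range (N + 1), densityCoeff (metricCoeff g φ) k ξ) = _
    rw [hsum, volumeDensity, mul_sub]

end Expansion

lemma isLeadingCoeff_of_two_le {n : ℕ} (hn : 2 ≤ n) :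
    IsLeadingCoeff.{u} n (-((n : ℝ) - 1) / (Nat.factorial (n + 1) : ℝ)) := by
  obtain ⟨k, rfl⟩ : ∃ k, n = k + 2 := ⟨n - 2, by omega⟩
  obtain ⟨L, hL, hθ⟩ := RadialData.exists_tracePoly k
  refine ⟨L, hL, fun m _ M _ _ _ g P φ hφ H hH ξ => ?_⟩
  obtain ⟨ρ, hρ, hG, hr, hG0⟩ := hφ.exists_ball
  have h0 : (0 : Coord m) ∈ Metric.ball (0 : Coord m) ρ := by simpa using hρ
  rw [hH.unique hφ.isDensityExpansion hn ξ]
  exact hθ (rayData hG Metric.isOpen_ball h0 hr hG0 ξ)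

/-! ### Rotationally twisted metrics on the plane -/

section Plane

open Bundle Bornology

/-- The linear form `v ↦ x₀ v₁ - x₁ v₀`. -/
def areaForm (x : Coord 2) : Coord 2 →L[ℝ] ℝ :=
  x 0 • EuclideanSpace.proj (𝕜 := ℝ) 1 - x 1 • EuclideanSpace.proj (𝕜 := ℝ) 0

lemma areaForm_apply (x v : Coord 2) : areaForm x v = x 0 * v 1 - x 1 * v 0 := by
  simp [areaForm]

/-- The bilinear form `⟪v, w⟫ + f(x) ω_x(v) ω_x(w)`, where `ω` is the area form. -/
def planeForm (f : Coord 2 → ℝ) (x : Coord 2) : Coord 2 →L[ℝ] Coord 2 →L[ℝ] ℝ :=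
  (EuclideanSpace.proj (𝕜 := ℝ) 0).smulRight (EuclideanSpace.proj (𝕜 := ℝ) 0) +
    (EuclideanSpace.proj (𝕜 := ℝ) 1).smulRight (EuclideanSpace.proj (𝕜 := ℝ) 1) + f x • (areaForm x).smulRight (areaForm x)

lemma planeForm_apply (f : Coord 2 → ℝ) (x v w : Coord 2) : planeForm f x v w =
    v 0 * w 0 + v 1 * w 1 + f x * (x 0 * v 1 - x 1 * v 0) * (x 0 * w 1 - x 1 * w 0) := by
  simp [planeForm, areaForm_apply]
  ring

/-- By Lagrange's identity `ω_x(v)² = |x|²|v|² - ⟪x, v⟫²`, so for `f x ≤ 0` the form is least, for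
given `‖v‖`, when `v ⊥ x`. For `f x ≥ 0` the added term only helps. -/
lemma le_planeForm (f : Coord 2 → ℝ) (x v : Coord 2) :
    min 1 (1 + f x * (x 0 ^ 2 + x 1 ^ 2)) * ‖v‖ ^ 2 ≤ planeForm f x v v := by
  rw [planeForm_apply, EuclideanSpace.real_norm_sq_eq, Fin.sum_univ_two]
  have hv : 0 ≤ v 0 ^ 2 + v 1 ^ 2 := by positivity
  rcases le_total 0 (f x) with h | h
  · have h1 := mul_le_mul_of_nonneg_right
      (min_le_left 1 (1 + f x * (x 0 ^ 2 + x 1 ^ 2))) hv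
    have h2 := mul_nonneg h (sq_nonneg (x 0 * v 1 - x 1 * v 0))
    nlinarith
  · have h1 := mul_le_mul_of_nonneg_right
      (min_le_right 1 (1 + f x * (x 0 ^ 2 + x 1 ^ 2))) hv
    have h2 := mul_nonneg (neg_nonneg.2 h) (sq_nonneg (x 0 * v 0 + x 1 * v 1))
    nlinarith

lemma contDiff_smul_normedSpace {E F : Type*} [NormedAddCommGroup E] [NormedSpace ℝ E]
    [NormedAddCommGroup F] [NormedSpace ℝ F] {f : E → ℝ} {B : E → F} (hf : ContDiff ℝ ∞ f)
    (hB : ContDiff ℝ ∞ B) : ContDiff ℝ ∞ (fun x => f x • B x) :=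
  hf.smul hB

lemma contDiff_planeForm {f : Coord 2 → ℝ} (hf : ContDiff ℝ ∞ f) : ContDiff ℝ ∞ (planeForm f) := by
  have h1 : ContDiff ℝ ∞ areaForm := by
    unfold areaForm
    fun_prop
  have h2 := h1.smulRight h1
  have h3 := contDiff_smul_normedSpace hf h2
  unfold planeForm
  exact contDiff_const.add h3

lemma planeForm_pos {f : Coord 2 → ℝ} {x : Coord 2} (hpos : 0 < 1 + f x * (x 0 ^ 2 + x 1 ^ 2))
    {v : Coord 2} (hv : v ≠ 0) : 0 < planeForm f x v v := by
  refine lt_of_lt_of_le ?_ (le_planeForm f x v)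
  have : 0 < ‖v‖ := norm_pos_iff.2 hv
  have h1 : 0 < min 1 (1 + f x * (x 0 ^ 2 + x 1 ^ 2)) := lt_min one_pos hpos
  positivity

lemma isVonNBounded_planeForm {f : Coord 2 → ℝ} {x : Coord 2}
    (hpos : 0 < 1 + f x * (x 0 ^ 2 + x 1 ^ 2)) :
    IsVonNBounded ℝ {v : Coord 2 | planeForm f x v v < 1} := by
  set δ := min 1 (1 + f x * (x 0 ^ 2 + x 1 ^ 2)) with hδ
  have h1 : 0 < δ := lt_min one_pos hpos
  refine (NormedSpace.isVonNBounded_ball ℝ (Coord 2) (√(1 / δ))).subset fun v hv => ?_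
  have h2 : δ * ‖v‖ ^ 2 < 1 := (le_planeForm f x v).trans_lt hv
  rw [mem_ball_zero_iff]
  refine Real.lt_sqrt_of_sq_lt ?_
  rwa [lt_div_iff₀ h1, mul_comm]

lemma trivializationAt_cotangent_apply {E : Type*} [NormedAddCommGroup E] [NormedSpace ℝ E]
    (x y : E) (L : TangentSpace 𝓘(ℝ, E) y →L[ℝ] ℝ) (w : E) :
    (trivializationAt (E →L[ℝ] ℝ) (fun x : E => TangentSpace 𝓘(ℝ, E) x →L[ℝ] ℝ) x ⟨y, L⟩).2 w
      = L w := by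
  have h := hom_trivializationAt_apply (RingHom.id ℝ) (F₁ := E)
    (E₁ := fun x : E => TangentSpace 𝓘(ℝ, E) x) (F₂ := ℝ) (E₂ := Bundle.Trivial E ℝ) x
    (TotalSpace.mk' (E →L[ℝ] ℝ) y L)
  refine (congrArg (fun p : E × (E →L[ℝ] ℝ) => p.2 w) h).trans ?_
  simp [ContinuousLinearMap.inCoordinates]
  rfl

/-- On a normed space the trivializations of the tangent bundle are the identity, so the section
read in them is `B` itself. -/
lemma contMDiff_bilinear_section {E : Type*} [NormedAddCommGroup E] [NormedSpace ℝ E]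
    {B : E → E →L[ℝ] E →L[ℝ] ℝ} (hB : ContDiff ℝ ∞ B)
    (V : ∀ x : E, TangentSpace 𝓘(ℝ, E) x →L[ℝ] TangentSpace 𝓘(ℝ, E) x →L[ℝ] ℝ)
    (hV : ∀ x, V x = B x) :
    ContMDiff 𝓘(ℝ, E) (𝓘(ℝ, E).prod 𝓘(ℝ, E →L[ℝ] E →L[ℝ] ℝ)) ∞
      (fun x => TotalSpace.mk' (E →L[ℝ] E →L[ℝ] ℝ) x (V x)) := by
  intro x
  rw [contMDiffAt_section]
  convert! hB.contMDiff.contMDiffAt using 1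
  ext y v w
  rw [← hV]
  simp [hom_trivializationAt_apply, ContinuousLinearMap.inCoordinates]
  rw [Trivialization.coe_linearMapAt_of_mem _ (by simp [chartAt_self_eq])]
  exact trivializationAt_cotangent_apply x y _ w

/-- The Riemannian metric on the plane with coefficients `planeForm f`. -/
def planeMetric (f : Coord 2 → ℝ) (hf : ContDiff ℝ ∞ f)
    (hpos : ∀ x : Coord 2, 0 < 1 + f x * (x 0 ^ 2 + x 1 ^ 2)) :
    Bundle.ContMDiffRiemannianMetric 𝓘(ℝ, Coord 2) ∞ (Coord 2)
      (fun p : Coord 2 => TangentSpace 𝓘(ℝ, Coord 2) p) where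
  inner x := planeForm f x
  symm x v w := by
    refine (planeForm_apply f x v w).trans (Eq.trans ?_ (planeForm_apply f x w v).symm)
    ring
  pos x v hv := planeForm_pos (hpos x) hv
  isVonNBounded x := isVonNBounded_planeForm (hpos x)
  contMDiff := contMDiff_bilinear_section (contDiff_planeForm hf) _ fun _ => rfl

end Plane

/-! ### Density, geodesics and connection of the plane metrics. -/

section PlaneGeometry

open Bundle Bornology

/-- The linear form `x ↦ ω_x(∂_i)`, where `ω` is the area form. -/
def areaCoeff (i : Fin 2) : Coord 2 →L[ℝ] ℝ :=
  if i = 0 then -EuclideanSpace.proj (𝕜 := ℝ) 1 else EuclideanSpace.proj (𝕜 := ℝ) 0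

lemma areaCoeff_zero (x : Coord 2) : areaCoeff 0 x = -x 1 := by simp [areaCoeff]

lemma areaCoeff_one (x : Coord 2) : areaCoeff 1 x = x 0 := by simp [areaCoeff]

variable {f : Coord 2 → ℝ} (hf : ContDiff ℝ ∞ f)
  (hpos : ∀ x : Coord 2, 0 < 1 + f x * (x 0 ^ 2 + x 1 ^ 2))

lemma metricCoeff_planeMetric (x : Coord 2) (i j : Fin 2) :
    metricCoeff (planeMetric f hf hpos) (OpenPartialHomeomorph.refl (Coord 2)) x i j =
      (if i = j then 1 else 0) + f x * areaCoeff i x * areaCoeff j x := by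
  have h1 : mfderiv 𝓘(ℝ, Coord 2) 𝓘(ℝ, Coord 2)
      (OpenPartialHomeomorph.refl (Coord 2)).symm x = ContinuousLinearMap.id ℝ (Coord 2) :=
    mfderiv_id
  have h2 : metricCoeff (planeMetric f hf hpos) (OpenPartialHomeomorph.refl (Coord 2)) x i j =
      planeForm f x (coordVec i) (coordVec j) := by
    unfold metricCoeff
    rw [Matrix.of_apply, h1]
    rfl
  rw [h2, planeForm_apply]
  fin_cases i <;> fin_cases j <;> simp [areaCoeff_zero, areaCoeff_one, coordVec]

lemma det_metricCoeff_planeMetric (x : Coord 2) :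
    (metricCoeff (planeMetric f hf hpos) (OpenPartialHomeomorph.refl (Coord 2)) x).det =
      1 + f x * (x 0 ^ 2 + x 1 ^ 2) := by
  rw [Matrix.det_fin_two]
  simp only [metricCoeff_planeMetric, areaCoeff_zero, areaCoeff_one]
  simp
  ring

lemma partialDeriv_metricCoeff_planeMetric (x : Coord 2) (a i j : Fin 2) :
    partialDeriv a (fun y => metricCoeff (planeMetric f hf hpos)
      (OpenPartialHomeomorph.refl (Coord 2)) y i j) x =
      partialDeriv a f x * areaCoeff i x * areaCoeff j x +
        f x * (areaCoeff i (coordVec a) * areaCoeff j x +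
          areaCoeff i x * areaCoeff j (coordVec a)) := by
  simp only [metricCoeff_planeMetric]
  have h1 : HasFDerivAt f (fderiv ℝ f x) x := (hf.differentiable (by simp) x).hasFDerivAt
  have h2 : HasFDerivAt (fun y => (if i = j then (1 : ℝ) else 0) +
      f y * areaCoeff i y * areaCoeff j y) _ x :=
    ((h1.mul (areaCoeff i).hasFDerivAt).mul (areaCoeff j).hasFDerivAt).const_add _
  rw [partialDeriv, h2.fderiv]
  simp only [add_apply, smul_apply, smul_eq_mul, partialDeriv, Pi.mul_apply]
  ring

lemma areaCoeff_coordVec : areaCoeff 0 (coordVec 0) = 0 ∧ areaCoeff 0 (coordVec 1) = -1 ∧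
    areaCoeff 1 (coordVec 0) = 1 ∧ areaCoeff 1 (coordVec 1) = 0 := by
  simp [areaCoeff_zero, areaCoeff_one, coordVec]

/-- Each term of the lowered `Γ(ξ, ξ)` has a factor `ω_{tξ}(ξ)` or `ω_ξ(ξ)`, and both are zero. So
the rays are geodesics whatever `f` is. -/
lemma christoffelVec_planeMetric (t : ℝ) (ξ : Coord 2) :
    christoffelVec (metricCoeff (planeMetric f hf hpos) (OpenPartialHomeomorph.refl (Coord 2)))
      (t • ξ) ξ ξ = 0 := by
  obtain ⟨h00, h01, h10, h11⟩ := areaCoeff_coordVec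
  ext s
  simp only [christoffelVec, christoffel, partialDeriv_metricCoeff_planeMetric, Fin.sum_univ_two,
    areaCoeff_zero, areaCoeff_one, h00, h01, h10, h11, PiLp.smul_apply, smul_eq_mul,
    PiLp.zero_apply]
  simp only [coordVec]
  simp
  ring

lemma sum_metricCoeff_planeMetric (t : ℝ) (ξ : Coord 2) :
    ∑ i, ∑ j, metricCoeff (planeMetric f hf hpos) (OpenPartialHomeomorph.refl (Coord 2)) (t • ξ) i j
      * ξ i * ξ j = ‖ξ‖ ^ 2 := by
  rw [EuclideanSpace.real_norm_sq_eq]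
  simp only [metricCoeff_planeMetric, Fin.sum_univ_two, areaCoeff_zero, areaCoeff_one,
    PiLp.smul_apply, smul_eq_mul]
  simp
  ring

lemma isGeodesicCoordinates_planeMetric : IsGeodesicCoordinates (planeMetric f hf hpos) 0
    (OpenPartialHomeomorph.refl (Coord 2)) where
  mem_maximalAtlas := IsManifold.subset_maximalAtlas (by simp)
  mem_source := by simp
  map_center := by simp
  geodesic := by
    refine ⟨1, one_pos, by simp, fun ξ hξ => ⟨by fun_prop, fun t _ => ?_⟩⟩
    have hderiv : deriv (fun t : ℝ => t • ξ) = fun _ => ξ := by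
      ext1 t
      simpa using ((hasDerivAt_id t).smul_const ξ).deriv
    simp only [hderiv, deriv_const, PiLp.zero_apply, zero_add]
    refine ⟨fun k => ?_, ?_⟩
    · exact congrFun (congrArg WithLp.ofLp (christoffelVec_planeMetric hf hpos t ξ)) k
    · rw [sum_metricCoeff_planeMetric, hξ, one_pow]

/-- On the first axis `ω(∂_0)` vanishes, so the metric is diagonal there with first entry 1. A
connection matrix with a single possible entry is determined by its trace. -/
lemma connMat_planeMetric (t : ℝ) (s j : Fin 2) :
    connMat (metricCoeff (planeMetric f hf hpos) (OpenPartialHomeomorph.refl (Coord 2)))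
      (coordVec 0) t s j = if s = 1 ∧ j = 1 then connMat (metricCoeff (planeMetric f hf hpos)
        (OpenPartialHomeomorph.refl (Coord 2))) (coordVec 0) t 1 1 else 0 := by
  obtain ⟨h00, h01, h10, h11⟩ := areaCoeff_coordVec
  have hG : metricCoeff (planeMetric f hf hpos) (OpenPartialHomeomorph.refl (Coord 2))
      (t • coordVec 0) 0 1 = 0 := by
    simp [metricCoeff_planeMetric, areaCoeff_zero, coordVec]
  have hinv : (metricCoeff (planeMetric f hf hpos) (OpenPartialHomeomorph.refl (Coord 2))
      (t • coordVec 0))⁻¹ 0 1 = 0 := by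
    rw [Matrix.inv_def, Matrix.smul_apply, Matrix.adjugate_fin_two]
    simp [hG]
  have e0 : (coordVec 0 : Coord 2) 0 = 1 := by simp [coordVec]
  have e1 : (coordVec 0 : Coord 2) 1 = 0 := by simp [coordVec]
  by_cases h : s = 1 ∧ j = 1
  · rw [if_pos h, h.1, h.2]
  · rw [if_neg h]
    fin_cases s <;> fin_cases j <;>
    simp [connMat, christoffel, partialDeriv_metricCoeff_planeMetric, Fin.sum_univ_two,
      areaCoeff_zero, areaCoeff_one, h00, h01, h10, h11, e0, e1, hinv] at h ⊢

end PlaneGeometry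

/-! ### A metric that isolates the leading term. -/

namespace RadialData

/-- The recurrence for `θ` read backwards: once the earlier traces vanish, `Tr(A i) θ 0` is the only
term left in the formula for `θ (i + 1)`. -/
lemma trace_A_eq_zero (d : RadialData) {n : ℕ} (h : ∀ j, 1 ≤ j → j < n → d.θ j = 0) (i : ℕ)
    (hi : i + 1 < n) : (d.A i).trace = 0 := by
  induction i using Nat.strong_induction_on with
  | _ i ih =>
    have h1 := d.θ_succ i
    rw [h (i + 1) (by omega) hi, mul_zero, Finset.sum_eq_single (i, 0), d.θ_zero, mul_one] at h1
    · exact h1.symm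
    · intro p hp hne
      have hp' := Finset.HasAntidiagonal.mem_antidiagonal.1 hp
      rw [ih p.1 ?_ (by omega), zero_mul]
      by_contra hlt
      exact hne (Prod.ext (by omega) (by simp only; omega))
    · intro hp
      exact absurd (Finset.HasAntidiagonal.mem_antidiagonal.2 (by simp)) hp

lemma J_eq_zero (d : RadialData) {n : ℕ} (h : ∀ i, i + 1 < n → d.A i = 0) (k : ℕ)
    (hk : k + 2 < n) : d.J k = 0 := by
  have h1 := d.A_succ k
  rw [h (k + 1) (by omega), Finset.sum_eq_zero, smul_zero, zero_add, eq_comm, neg_eq_zero] at h1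
  · exact (smul_eq_zero.1 h1).resolve_left (by positivity)
  · intro p hp
    have hp' := Finset.HasAntidiagonal.mem_antidiagonal.1 hp
    rw [h p.1 (by omega), zero_mul]

end RadialData

/-- Only the last diagonal entry of the `2 × 2` matrix `X` may be nonzero. -/
def IsCornerMatrix (X : Matrix (Fin 2) (Fin 2) ℝ) : Prop :=
  ∀ s j, ¬(s = 1 ∧ j = 1) → X s j = 0

lemma IsCornerMatrix.mul {X Y : Matrix (Fin 2) (Fin 2) ℝ} (hX : IsCornerMatrix X) (hY : IsCornerMatrix Y) :
    IsCornerMatrix (X * Y) := by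
  intro s j h
  rw [Matrix.mul_apply]
  refine Finset.sum_eq_zero fun u _ => ?_
  by_cases hs : s = 1
  · rw [hY u j fun hj => h ⟨hs, hj.2⟩, mul_zero]
  · rw [hX s u fun hu => hs hu.1, zero_mul]

lemma IsCornerMatrix.iterate_covD {A : ℝ → Matrix (Fin 2) (Fin 2) ℝ} (hA : ∀ t, IsCornerMatrix (A t)) (k : ℕ) :
    ∀ t, IsCornerMatrix ((covD A)^[k] A t) := by
  induction k with
  | zero => exact hA
  | succ k ih =>
    intro t s j h
    rw [Function.iterate_succ_apply', covD, Matrix.sub_apply, Matrix.add_apply,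
      (hA t).mul (ih t) s j h, (ih t).mul (hA t) s j h, derivMat, Matrix.of_apply]
    simp [fun t => ih t s j h]

lemma IsCornerMatrix.eq_zero {X : Matrix (Fin 2) (Fin 2) ℝ} (hX : IsCornerMatrix X) (h : X.trace = 0) :
    X = 0 := by
  rw [Matrix.trace_fin_two, hX 0 0 (by simp), zero_add] at h
  ext s j
  by_cases hsj : s = 1 ∧ j = 1
  · rw [hsj.1, hsj.2, h, Matrix.zero_apply]
  · exact hX s j hsj

lemma isDerivTower_pow (n : ℕ) :
    IsDerivTower Set.univ (fun k t => (n.choose k : ℝ) * t ^ (n - k)) := by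
  intro k t _
  refine ((hasDerivAt_pow (n - k) t).const_mul (n.choose k : ℝ)).congr_deriv ?_
  have h : ((n.choose (k + 1) : ℕ) : ℝ) * ((k : ℝ) + 1) = n.choose k * ((n - k : ℕ) : ℝ) := by
    exact_mod_cast Nat.choose_succ_right_eq n k
  rw [← mul_assoc, ← h, Nat.sub_sub]
  ring

lemma taylorCoeff_one_add_pow_add_pow (n k : ℕ) :
    (k.factorial : ℝ)⁻¹ * iteratedDeriv k (fun t : ℝ => 1 + t ^ n + t ^ (2 * n)) 0 =
      ((0 : ℕ).choose k : ℝ) * 0 ^ (0 - k) + (n.choose k : ℝ) * 0 ^ (n - k) +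
        ((2 * n).choose k : ℝ) * 0 ^ (2 * n - k) := by
  have h1 := isDerivTower_of_contDiffOn (I := Set.univ) isOpen_univ
    (f := fun t : ℝ => 1 + t ^ n + t ^ (2 * n)) (by fun_prop)
  -- The constant 1 is treated as `t ^ 0`. The truncated exponents are harmless, since the binomial
  -- coefficients vanish beyond the degree.
  have h2 : IsDerivTower Set.univ (fun k t => ((0 : ℕ).choose k : ℝ) * t ^ (0 - k) +
      (n.choose k : ℝ) * t ^ (n - k) + ((2 * n).choose k : ℝ) * t ^ (2 * n - k)) := by
    intro k t ht
    refine (((isDerivTower_pow 0 k t ht).add (isDerivTower_pow n k t ht)).add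
      (isDerivTower_pow (2 * n) k t ht)).congr_deriv ?_
    ring
  exact h1.eq isOpen_univ h2 (fun t _ => by simp) k 0 (Set.mem_univ _)

/-- In geodesic coordinates on the plane, there is a metric with `J_k = 0` for `k < n - 2` in some
direction, whose density has a nonzero term of order `n`. -/
lemma exists_planeMetric {n : ℕ} (hn : 2 ≤ n) :
    ∃ (g : Bundle.ContMDiffRiemannianMetric 𝓘(ℝ, Coord 2) ∞ (Coord 2)
      (fun p : Coord 2 => TangentSpace 𝓘(ℝ, Coord 2) p))
      (φ : OpenPartialHomeomorph (Coord 2) (Coord 2)) (_ : IsGeodesicCoordinates g 0 φ)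
      (ξ : Coord 2), (∀ k, k + 2 < n → jacobiOp (metricCoeff g φ) 0 k ξ = 0) ∧
      densityCoeff (metricCoeff g φ) n ξ = 1 := by
  set u : Coord 2 → ℝ := fun x => x 0 ^ (n - 2) * (x 0 ^ 2 + x 1 ^ 2) with hu
  -- `f` solves `1 + f |x|² = (1 + u + u²)²`. The factor `|x|²` in `u` makes this solution a
  -- polynomial, the term `u²` keeps `1 + u + u²` positive on the whole plane even where `u < 0`,
  -- and the power of `x 0` gives `u = t^n` on the first axis.
  set f : Coord 2 → ℝ := fun x => x 0 ^ (n - 2) * (2 + 3 * u x + 2 * u x ^ 2 + u x ^ 3) with hfdef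
  have hf : ContDiff ℝ ∞ f := by
    simp only [hfdef, hu]
    fun_prop
  have hdet : ∀ x : Coord 2, 1 + f x * (x 0 ^ 2 + x 1 ^ 2) = (1 + u x + u x ^ 2) ^ 2 := by
    intro x
    have : f x * (x 0 ^ 2 + x 1 ^ 2) = u x * (2 + 3 * u x + 2 * u x ^ 2 + u x ^ 3) := by
      simp only [hfdef, hu]
      ring
    rw [this]
    ring
  have hψ : ∀ x, 0 < 1 + u x + u x ^ 2 := fun x => by nlinarith [sq_nonneg (u x + 1 / 2)]
  have hpos : ∀ x : Coord 2, 0 < 1 + f x * (x 0 ^ 2 + x 1 ^ 2) := fun x => by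
    rw [hdet]
    exact pow_pos (hψ x) 2
  have hgeo := isGeodesicCoordinates_planeMetric hf hpos
  set g := planeMetric f hf hpos with hg
  set G := metricCoeff g (OpenPartialHomeomorph.refl (Coord 2)) with hGdef
  have hθ : ∀ k, densityCoeff G k (coordVec 0) =
      ((0 : ℕ).choose k : ℝ) * 0 ^ (0 - k) + (n.choose k : ℝ) * 0 ^ (n - k) +
        ((2 * n).choose k : ℝ) * 0 ^ (2 * n - k) := by
    intro k
    rw [← taylorCoeff_one_add_pow_add_pow, densityCoeff]
    congr 3
    ext t
    have hut : u (t • coordVec 0) = t ^ n := by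
      simp only [hu, coordVec, PiLp.smul_apply, PiLp.single_apply, smul_eq_mul]
      simp only [if_true, mul_one, one_ne_zero, if_false, mul_zero, ne_eq, OfNat.ofNat_ne_zero,
        not_false_eq_true, zero_pow, add_zero, ← pow_add]
      congr 1
      omega
    rw [hGdef, hg, det_metricCoeff_planeMetric, hdet, Real.sqrt_sq (hψ _).le, hut]
    ring
  refine ⟨g, OpenPartialHomeomorph.refl (Coord 2), hgeo, coordVec 0, ?_, ?_⟩
  · obtain ⟨ρ, hρ, hG, hr, hG0⟩ := hgeo.exists_ball
    have h0 : (0 : Coord 2) ∈ Metric.ball (0 : Coord 2) ρ := by simpa using hρ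
    set d := rayData hG Metric.isOpen_ball h0 hr hG0 (coordVec 0) with hd
    have hθ0 : ∀ j, 1 ≤ j → j < n → d.θ j = 0 := by
      intro j hj hjn
      refine (hθ j).trans ?_
      rw [Nat.choose_eq_zero_of_lt (by omega : 0 < j), zero_pow (by omega : n - j ≠ 0),
        zero_pow (by omega : 2 * n - j ≠ 0)]
      simp
    have hcorner : ∀ t, IsCornerMatrix (connMat G (coordVec 0) t) := by
      intro t s j h
      rw [hGdef, hg, connMat_planeMetric, if_neg h]
    have hA : ∀ i, i + 1 < n → d.A i = 0 := by
      intro i hi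
      have h1 : IsCornerMatrix (d.A i) := by
        intro s j h
        change ((i.factorial : ℝ)⁻¹ • ((covD (connMat G (coordVec 0)))^[i]
          (connMat G (coordVec 0))) 0) s j = 0
        rw [Matrix.smul_apply, IsCornerMatrix.iterate_covD hcorner i 0 s j h, smul_zero]
      exact h1.eq_zero (d.trace_A_eq_zero hθ0 i hi)
    exact fun k hk => d.J_eq_zero hA k hk
  · rw [hθ n, Nat.choose_eq_zero_of_lt (by omega : 0 < n), zero_pow (by omega : 2 * n - n ≠ 0)]
    simp

/-- On the test metric both expressions reduce to `1 = c Tr J_{n-2} = c' Tr J_{n-2}`; the value 1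
also shows that the trace is nonzero. -/
lemma IsLeadingCoeff.eq {n : ℕ} (hn : 2 ≤ n) {c c' : ℝ} (h : IsLeadingCoeff.{0} n c)
    (h' : IsLeadingCoeff.{0} n c') : c = c' := by
  obtain ⟨g, φ, hφ, ξ, hJ, hθ⟩ := exists_planeMetric hn
  obtain ⟨L, hL, hc⟩ := h
  obtain ⟨L', hL', hc'⟩ := h'
  have h1 := hc 2 le_rfl (Coord 2) g 0 φ hφ _ hφ.isDensityExpansion ξ
  have h2 := hc' 2 le_rfl (Coord 2) g 0 φ hφ _ hφ.isDensityExpansion ξ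
  rw [hθ, hL.value_eq_zero (by omega) hJ, add_zero] at h1
  rw [hθ, hL'.value_eq_zero (by omega) hJ, add_zero] at h2
  refine mul_right_cancel₀ (b := (jacobiOp (metricCoeff g φ) 0 (n - 2) ξ).trace) ?_
    (h1.symm.trans h2)
  intro h0
  rw [h0, mul_zero] at h1
  exact one_ne_zero h1

end

theorem lemma1p2 :
    (∀ (m : ℕ) (_ : 2 ≤ m) (M : Type u) [TopologicalSpace M] [ChartedSpace (Coord m) M]
      [IsManifold 𝓘(ℝ, Coord m) ∞ M]
      (g : Bundle.ContMDiffRiemannianMetric 𝓘(ℝ, Coord m) ∞ (Coord m)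
        (fun p : M => TangentSpace 𝓘(ℝ, Coord m) p))
      (P : M) (φ : OpenPartialHomeomorph M (Coord m)),
      IsGeodesicCoordinates g P φ → ∃ H : ℕ → Coord m → ℝ, IsDensityExpansion g φ H) ∧
    ∀ n : ℕ, 2 ≤ n →
      IsLeadingCoeff.{u} n (-((n : ℝ) - 1) / (Nat.factorial (n + 1) : ℝ)) ∧
      ∀ c : ℝ, IsLeadingCoeff.{0} n c →
        c = -((n : ℝ) - 1) / (Nat.factorial (n + 1) : ℝ) :=
  ⟨fun _ _ _ _ _ _ _ _ _ h => ⟨_, h.isDensityExpansion⟩, fun _ hn =>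
    -- The existence result, used again in universe 0 where the test plane lives, supplies the
    -- constant to compare with.
    ⟨isLeadingCoeff_of_two_le hn, fun _ hc => hc.eq hn (isLeadingCoeff_of_two_le hn)⟩⟩
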